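/- Let $Q$ be a (not necessarily convex) polygon in the plane $\mathbb{C}$, with a triangulation $T(Q)$ of its interior whose boundary edges are the edges of $Q$. More generally, $T(Q)$ may be immersed: it is a finite triangulation of the closed disc together with a locally injective map to $\mathbb{C}$ that is affine on each triangle and maps it to a non-degenerate triangle; the vertices and edges of $Q$ are then the boundary vertices and boundary edges. Use the upper half-space model of hyperbolic space $\mathbb{H}^3$, with ideal boundary $\mathbb{C}\cup\{\infty\}$. The ideal polyhedron $\tilde Q$ associated with $T(Q)$ is the union, over all triangles $ABC$ of $T(Q)$, of the ideal tetrahedra with vertices $\infty, A, B, C$, that is, of the sets of points that lie vertically above the triangle $ABC$ and on or above the hemisphere centred on $\mathbb{C}$ through $A$, $B$, $C$ (if the map is not injective, these tetrahedra are glued abstractly along common faces). The 1-skeleton of $\tilde Q$ is the graph whose vertices are the vertices of $T(Q)$ and $\infty$, and whose edges are the edges of $T(Q)$ and the pairs $\{v,\infty\}$ with $v$ a vertex of $Q$. An edge $\{A,B\}$ or $\{v,\infty\}$ is realized by the geodesic with these endpoints, and the dihedral angle of $\tilde Q$ at it is the angle measured through the interior of $\tilde Q$ (it may be $\pi$ or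 larger). A set of edges of a graph is a cutset if its removal disconnects the graph, and a cutset is minimal if no proper subset of it is a cutset. Let $\{e_1,\dots,e_k\}$, with the $e_i$ distinct, be a minimal cutset of the 1-skeleton of $\tilde Q$, and let $\Sigma$ be the sum of the dihedral angles of $\tilde Q$ at $e_1,\dots,e_k$. If $e_1,\dots,e_k$ are not all incident to one vertex, then $\Sigma<(k-2)\pi$. If $e_1,\dots,e_k$ are all incident to one vertex, then $\Sigma=(k-2)\pi$. -/

import Mathlib

open Filter Topology MeasureTheory

noncomputable section

namespace IdealPolyhedron

/-! ### Cutsets -/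

/-- A cutset of `G`: a set of edges of `G` whose removal disconnects `G`. -/
def IsCutset {W : Type*} (G : SimpleGraph W) (C : Finset (Sym2 W)) : Prop :=
  (C : Set (Sym2 W)) ⊆ G.edgeSet ∧ ¬ (G.deleteEdges (C : Set (Sym2 W))).Connected

/-- A minimal cutset: a cutset none of whose proper subsets is a cutset. -/
def IsMinimalCutset {W : Type*} (G : SimpleGraph W) (C : Finset (Sym2 W)) : Prop :=
  IsCutset G C ∧ ∀ C' : Finset (Sym2 W), C' ⊂ C → ¬ IsCutset G C'

/-! ### Triangulated discs

A pure two-dimensional simplicial complex on the vertex set `V` is given by its set `𝒯` of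
triangles, which are three-element subsets of `V`. -/

section Disc

variable {V : Type*} [DecidableEq V]

/-- The 1-skeleton of the complex with triangles `𝒯`. -/
def skeleton (𝒯 : Finset (Finset V)) : SimpleGraph V where
  Adj a b := a ≠ b ∧ ∃ T ∈ 𝒯, a ∈ T ∧ b ∈ T
  symm := ⟨fun _ _ h => ⟨h.1.symm, h.2.imp fun _ hT => ⟨hT.1, hT.2.2, hT.2.1⟩⟩⟩
  loopless := ⟨fun _ h => h.1 rfl⟩

/-- The link of the vertex `v`: its vertices are the neighbours of `v`, and its edges are
the sides opposite to `v` of the triangles that contain `v`. -/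
def link (𝒯 : Finset (Finset V)) (v : V) : SimpleGraph {w : V // (skeleton 𝒯).Adj v w} where
  Adj x y := x ≠ y ∧ ({v, x.1, y.1} : Finset V) ∈ 𝒯
  symm := ⟨fun x y h => ⟨h.1.symm, by
    have e : ({v, y.1, x.1} : Finset V) = {v, x.1, y.1} := by
      ext z; simp only [Finset.mem_insert, Finset.mem_singleton]; tauto
    rw [e]; exact h.2⟩⟩
  loopless := ⟨fun _ h => h.1 rfl⟩

/-- The number of triangles that contain both `a` and `b`. -/
def numTriangles (𝒯 : Finset (Finset V)) (a b : V) : ℕ :=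
  (𝒯.filter fun T => a ∈ T ∧ b ∈ T).card

/-- `a b` is a boundary edge: an edge that lies in exactly one triangle. -/
def IsBoundaryEdge (𝒯 : Finset (Finset V)) (a b : V) : Prop :=
  a ≠ b ∧ numTriangles 𝒯 a b = 1

/-- A boundary vertex is an endpoint of a boundary edge. -/
def IsBoundaryVertex (𝒯 : Finset (Finset V)) (a : V) : Prop :=
  ∃ b, IsBoundaryEdge 𝒯 a b

/-- Homotopy (with fixed endpoints) of edge paths in the complex with triangles `𝒯`: the
congruence generated by cancelling an edge that is traversed back and forth and by replacing
two sides of a triangle by the third one. -/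
inductive EdgeHomotopic (𝒯 : Finset (Finset V)) :
    ∀ {u v : V}, (skeleton 𝒯).Walk u v → (skeleton 𝒯).Walk u v → Prop
  | refl {u v : V} (p : (skeleton 𝒯).Walk u v) : EdgeHomotopic 𝒯 p p
  | symm {u v : V} {p q : (skeleton 𝒯).Walk u v} :
      EdgeHomotopic 𝒯 p q → EdgeHomotopic 𝒯 q p
  | trans {u v : V} {p q r : (skeleton 𝒯).Walk u v} :
      EdgeHomotopic 𝒯 p q → EdgeHomotopic 𝒯 q r → EdgeHomotopic 𝒯 p r
  | cons {u v w : V} (h : (skeleton 𝒯).Adj u v) {p q : (skeleton 𝒯).Walk v w} :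
      EdgeHomotopic 𝒯 p q → EdgeHomotopic 𝒯 (.cons h p) (.cons h q)
  | backtrack {u v w : V} (h : (skeleton 𝒯).Adj u v) (p : (skeleton 𝒯).Walk u w) :
      EdgeHomotopic 𝒯 (.cons h (.cons h.symm p)) p
  | triangle {u v x w : V} (huv : (skeleton 𝒯).Adj u v) (hvx : (skeleton 𝒯).Adj v x)
      (hux : (skeleton 𝒯).Adj u x) (hT : ({u, v, x} : Finset V) ∈ 𝒯)
      (p : (skeleton 𝒯).Walk x w) :
      EdgeHomotopic 𝒯 (.cons huv (.cons hvx p)) (.cons hux p)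

/-- The complex with triangles `𝒯` is a triangulation of the closed disc: it is a compact
surface with boundary (every edge lies in at most two triangles and every vertex link is
connected, so that every vertex link is a path or a cycle), its boundary is not empty, and it
is connected and simply connected. -/
structure IsTriangulatedDisc (𝒯 : Finset (Finset V)) : Prop where
  card_eq_three : ∀ T ∈ 𝒯, T.card = 3
  numTriangles_le_two : ∀ a b, a ≠ b → numTriangles 𝒯 a b ≤ 2
  link_connected : ∀ v, (link 𝒯 v).Connected
  boundary_nonempty : ∃ a, IsBoundaryVertex 𝒯 a
  connected : (skeleton 𝒯).Connected
  simplyConnected : ∀ (v : V) (p : (skeleton 𝒯).Walk v v), EdgeHomotopic 𝒯 p .nil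

end Disc

/-! ### Triangulated polygons in the plane -/

/-- A triangulated polygon `Q` in the plane `ℂ`: a triangulated disc that is mapped to `ℂ`
affinely on each triangle, with non-degenerate triangles, by an immersion. Since the map is
affine on triangles, being an immersion (a locally injective map) means that two closed
triangles with a common vertex meet exactly along their common face. The polygon may
overlap itself; a simple polygon with a triangulation of its interior is the case where the map
is injective. The vertices of `Q` are the boundary vertices. -/
structure TriangulatedPolygon (V : Type*) [DecidableEq V] where
  /-- the triangles, as sets of vertices -/
  triangles : Finset (Finset V)
  /-- the positions of the vertices in the plane -/
  pos : V → ℂ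
  isTriangulatedDisc : IsTriangulatedDisc triangles
  nondegenerate : ∀ T ∈ triangles, AffineIndependent ℝ (fun v : T => pos v)
  immersed : ∀ T ∈ triangles, ∀ T' ∈ triangles, (T ∩ T').Nonempty →
    convexHull ℝ (pos '' (T : Set V)) ∩ convexHull ℝ (pos '' (T' : Set V)) ⊆
      convexHull ℝ (pos '' ((T ∩ T' : Finset V) : Set V))

/-! ### Hyperbolic geometry

Hyperbolic space is the upper half-space `{(z, t) : ℂ × ℝ | 0 < t}`, with ideal boundary
`ℂ ∪ {∞}`. The model is conformal, so hyperbolic angles are Euclidean angles. -/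

/-- The dihedral angle at the point `p` of a solid `K` along an edge through `p`, where `n₁`,
`n₂` is an orthonormal basis of the plane orthogonal to the edge at `p`: the angular measure
of the set of directions orthogonal to the edge that point into `K`. It may exceed `π`. -/
def dihedralAngleAt (K : Set (ℂ × ℝ)) (p n₁ n₂ : ℂ × ℝ) : ℝ :=
  (volume {φ : ℝ | φ ∈ Set.Icc (-Real.pi) Real.pi ∧
    ∀ᶠ s : ℝ in 𝓝[>] 0, p + s • (Real.cos φ • n₁ + Real.sin φ • n₂) ∈ K}).toReal

lemma dihedralAngleAt_neg (K : Set (ℂ × ℝ)) (p n₁ n₂ : ℂ × ℝ) :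
    dihedralAngleAt K p n₁ (-n₂) = dihedralAngleAt K p n₁ n₂ := by
  unfold dihedralAngleAt
  rw [← Measure.measure_neg]
  congr 2
  ext φ
  simp only [Set.mem_neg, Set.mem_ofPred_eq, Set.mem_Icc, Real.cos_neg, Real.sin_neg, smul_neg,
    neg_smul, neg_neg]
  constructor <;> rintro ⟨⟨h₁, h₂⟩, h⟩ <;> exact ⟨⟨by linarith, by linarith⟩, h⟩

namespace TriangulatedPolygon

variable {V : Type*} [DecidableEq V] (Q : TriangulatedPolygon V)

/-- The ideal tetrahedron spanned by `∞` and the three vertices of the triangle `T`: the part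
of hyperbolic space that lies vertically above the triangle and on or above the hyperbolic
plane (a hemisphere, centred on the plane `ℂ`) through its three vertices. -/
def idealTetrahedron (T : Finset V) : Set (ℂ × ℝ) :=
  {x | 0 < x.2 ∧ x.1 ∈ convexHull ℝ (Q.pos '' (T : Set V)) ∧
    ∃ (c : ℂ) (r : ℝ), (∀ v ∈ T, dist (Q.pos v) c = r) ∧ r ^ 2 ≤ dist x.1 c ^ 2 + x.2 ^ 2}

/-- The part near the faces that contain all of the vertices `σ` of the ideal polyhedron `Q̃`
of `Q`. The polyhedron `Q̃` is the union of the ideal tetrahedra over all triangles (glued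
along their common faces if `Q` overlaps itself); those over the triangles that contain `σ`
form a neighbourhood in `Q̃` of the edge over `σ` (an edge of the triangulation, or a vertex
`v`, which stands for the edge from `v` to `∞`). -/
def localSolid (σ : Finset V) : Set (ℂ × ℝ) :=
  ⋃ T ∈ Q.triangles.filter (fun T => σ ⊆ T), Q.idealTetrahedron T

/-- The dihedral angle of `Q̃` at the edge `a b`, a half circle over the segment from `a` to
`b`. It is measured at the top of the half circle, where the edge is parallel to that segment,
so that the upward direction and the horizontal normal of the segment span the orthogonal
plane. -/
def dihedralFinite (a b : V) : ℝ :=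
  dihedralAngleAt (Q.localSolid {a, b})
    ((Q.pos a + Q.pos b) / 2, dist (Q.pos a) (Q.pos b) / 2)
    (0, 1)
    (Complex.I * (Q.pos b - Q.pos a) / (dist (Q.pos a) (Q.pos b) : ℂ), 0)

/-- The dihedral angle of `Q̃` at the edge from `a` to `∞`, a vertical half line. -/
def dihedralInfinite (a : V) : ℝ :=
  dihedralAngleAt (Q.localSolid {a}) (Q.pos a, 1) (1, 0) (Complex.I, 0)

lemma dihedralFinite_comm (a b : V) : Q.dihedralFinite a b = Q.dihedralFinite b a := by
  unfold dihedralFinite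
  rw [← dihedralAngleAt_neg, Finset.pair_comm a b, add_comm (Q.pos a), dist_comm (Q.pos a)]
  congr 1
  ext1
  · simp only [Prod.fst_neg]; ring
  · simp

/-- The 1-skeleton of `Q̃`: its vertices are those of the triangulation and `∞` (which is
`none`), its edges are those of the triangulation and the edges from the vertices of the
polygon to `∞`. -/
def polyhedronSkeleton : SimpleGraph (Option V) where
  Adj
    | some a, some b => (skeleton Q.triangles).Adj a b
    | some a, none => IsBoundaryVertex Q.triangles a
    | none, some b => IsBoundaryVertex Q.triangles b
    | none, none => False
  symm := ⟨by
    rintro (_ | a) (_ | b) h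
    · exact h
    · exact h
    · exact h
    · exact SimpleGraph.Adj.symm (G := skeleton Q.triangles) h⟩
  loopless := ⟨by
    rintro (_ | a) h
    · exact h
    · exact (skeleton Q.triangles).irrefl h⟩

/-- The dihedral angle of `Q̃` at an edge of its 1-skeleton (the value at the non-edge
`{∞, ∞}` is immaterial). -/
def dihedralAngle : Sym2 (Option V) → ℝ :=
  Sym2.lift ⟨fun x y => match x, y with
    | some a, some b => Q.dihedralFinite a b
    | some a, none => Q.dihedralInfinite a
    | none, some b => Q.dihedralInfinite b
    | none, none => 0, by
    rintro (_ | a) (_ | b)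
    · rfl
    · rfl
    · rfl
    · exact Q.dihedralFinite_comm a b⟩

end TriangulatedPolygon

end IdealPolyhedron

end

/-! The angle sum is split into contributions of single triangles. A minimal cutset is the set of
edges between two complementary connected vertex sets (`IsMinimalCutset.exists_side`); let `A` be
the side without `∞`. The cut then consists of the triangulation edges leaving `A` and the edges
from boundary vertices in `A` to `∞`.

Dihedral angles reduce to plane angles. At an edge of the triangulation the dihedral angle is the
sum of the opposite angles of the adjacent triangles (`dihedralFinite_eq`). At the edge from `v` to
`∞` it is the sum of the triangle angles at `v` (`dihedralInfinite_eq`), and the corresponding sum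
at an interior vertex is `2π` (`sum_angleAt_of_interior`).

The number `k` of cut edges comes from topology. The full subcomplex on `A` has Euler characteristic
`1` (`euler_characteristic`): it is connected, and a cycle in it bounds a chain in the disc that
cannot reach the other side, because that side is connected to `∞`. Together with a count of degrees
this gives `card_cut`.

Combining these, the angle sum is `(k - 2)π` plus the sum of `defect A T` over all triangles
(`sum_dihedralAngle`). If `T` has `i` vertices in `A`, with angle sum `α`, the defect is `(i - 1)(2α
- iπ)`, increased by `2π` when `i = 3`. This vanishes for `i = 0, 1, 3`; for `i = 2` it is minus
twice the angle at the vertex outside `A`.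

Finally, a triangle with exactly two vertices in `A` exists if and only if the cut edges have no
common endpoint (`exists_common_vertex`, `card_inter_ne_two`). Without such triangles, connectedness
of links forces `A` to be one vertex or everything, so that the cut consists of edges at that vertex
or at `∞`. -/

namespace IdealPolyhedron

/-! ### Minimal cutsets and their two connected sides. -/

/-- A set of vertices `A` is linked in `G` if every property that spreads along the edges of `G`
inside `A` and holds somewhere on `A` holds on all of `A`. -/
def IsLinked {W : Type*} (G : SimpleGraph W) (A : Set W) : Prop :=
  ∀ P : W → Prop, ∀ a ∈ A, P a → (∀ x ∈ A, ∀ y ∈ A, G.Adj x y → P x → P y) → ∀ x ∈ A, P x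

lemma isLinked_of_reachable {W : Type*} {G H : SimpleGraph W} (hHG : H ≤ G) (o : W) :
    IsLinked G {x | H.Reachable o x} := by
  intro P a ha hPa hP
  have key : ∀ {x y : W}, H.Walk x y → H.Reachable o x → P x → P y := by
    intro x y w
    induction w with
    | nil => exact fun _ h => h
    | cons h p ih =>
      intro hx hPx
      have hv := hx.trans h.reachable
      exact ih hv (hP _ hx _ hv (hHG h) hPx)
  intro x hx
  obtain ⟨w⟩ := (SimpleGraph.Reachable.symm ha).trans hx
  exact key w ha hPa

lemma isLinked_univ_of_connected {W : Type*} {G : SimpleGraph W} (hG : G.Connected) :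
    IsLinked G Set.univ := by
  obtain ⟨o⟩ := hG.nonempty
  have := isLinked_of_reachable (le_refl G) o
  rwa [Set.eq_univ_of_forall (s := {x | G.Reachable o x}) fun x => hG.preconnected o x] at this

/-- A cut of a component of `G` minus a minimal cutset is the whole cutset. -/
lemma IsMinimalCutset.mem_iff_of_component {W : Type*} {G : SimpleGraph W}
    {C : Finset (Sym2 W)} (hC : IsMinimalCutset G C) (o z : W)
    (hz : ¬ (G.deleteEdges (C : Set (Sym2 W))).Reachable o z) {x y : W} :
    s(x, y) ∈ C ↔ G.Adj x y ∧ ¬ ((G.deleteEdges (C : Set (Sym2 W))).Reachable o x ↔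
      (G.deleteEdges (C : Set (Sym2 W))).Reachable o y) := by
  classical
  set H := G.deleteEdges (C : Set (Sym2 W)) with hH
  have hback : ∀ x y, G.Adj x y → ¬ (H.Reachable o x ↔ H.Reachable o y) → s(x, y) ∈ C := by
    intro x y hxy hne
    by_contra hmem
    have hadj : H.Adj x y := by
      rw [hH, SimpleGraph.deleteEdges_adj]; exact ⟨hxy, by simpa using hmem⟩
    exact hne ⟨fun h => h.trans hadj.reachable, fun h => h.trans hadj.symm.reachable⟩
  refine ⟨fun h => ?_, fun h => hback x y h.1 h.2⟩
  have hGxy : G.Adj x y := by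
    have := hC.1.1 (Finset.mem_coe.2 h); simpa using this
  refine ⟨hGxy, fun hiff => ?_⟩
  -- A cut edge with both ends on the same side can be restored and `z` still stays unreachable from
  -- `o`, against minimality.
  refine hC.2 (C.erase s(x, y)) (Finset.erase_ssubset h)
    ⟨fun e he => hC.1.1 (Finset.mem_of_mem_erase (Finset.mem_coe.1 he)), fun hconn => hz ?_⟩
  refine isLinked_univ_of_connected hconn (fun t => H.Reachable o t) o trivial
    (SimpleGraph.Reachable.refl o) (fun u _ v _ huv hu => ?_) z trivial
  rw [SimpleGraph.deleteEdges_adj] at huv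
  by_cases he : s(u, v) = s(x, y)
  · rcases Sym2.eq_iff.1 he with ⟨rfl, rfl⟩ | ⟨rfl, rfl⟩
    · exact hiff.1 hu
    · exact hiff.2 hu
  · have : s(u, v) ∉ C := fun hm => huv.2
      (Finset.mem_coe.2 (Finset.mem_erase.2 ⟨he, hm⟩))
    by_contra hv
    exact this (hback u v huv.1 fun h => hv (h.1 hu))

/-- A minimal cutset of a connected graph consists of the edges between two complementary
connected sets of vertices. -/
lemma IsMinimalCutset.exists_side {W : Type*} {G : SimpleGraph W} (hG : G.Connected)
    {C : Finset (Sym2 W)} (hC : IsMinimalCutset G C) (o : W) :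
    ∃ A : Set W, o ∉ A ∧ A.Nonempty ∧ IsLinked G A ∧ IsLinked G Aᶜ ∧
      ∀ x y, s(x, y) ∈ C ↔ G.Adj x y ∧ ¬ (x ∈ A ↔ y ∈ A) := by
  set H := G.deleteEdges (C : Set (Sym2 W)) with hH
  have hHG : H ≤ G := SimpleGraph.deleteEdges_le _
  obtain ⟨z, hz⟩ : ∃ z, ¬ H.Reachable o z := by
    by_contra! h
    have : Nonempty W := ⟨o⟩
    exact hC.1.2 ⟨fun x y => (h x).symm.trans (h y)⟩
  have hzo : ¬ H.Reachable z o := fun h => hz h.symm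
  -- There is no third component: an edge leaving it for one of the two components lies in `C`, so
  -- it must separate both of them from their complements, and its far end would lie in both at
  -- once. Connectedness of `G` would then put `o` in the third component.
  have hAB : ∀ x, H.Reachable z x ↔ ¬ H.Reachable o x := by
    by_contra! hne
    obtain ⟨y, hy⟩ := hne
    have hy2 : ¬ H.Reachable z y ∧ ¬ H.Reachable o y := by
      rcases hy with h | h
      · exact absurd (h.2.trans h.1.symm) hz
      · exact h
    have := isLinked_univ_of_connected hG
      (fun t => ¬ H.Reachable z t ∧ ¬ H.Reachable o t) y trivial hy2 ?_ o trivial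
    · exact this.2 (SimpleGraph.Reachable.refl o)
    · intro u _ v _ huv hu
      have h1 := (hC.mem_iff_of_component o z hz (x := u) (y := v))
      have h2 := (hC.mem_iff_of_component z o hzo (x := u) (y := v))
      rw [← hH] at h1 h2
      have : H.Reachable o v → H.Reachable z v → False := fun a b => hz (a.trans b.symm)
      tauto
  refine ⟨{x | H.Reachable z x}, hzo, ⟨z, SimpleGraph.Reachable.refl z⟩,
    isLinked_of_reachable hHG z, ?_, fun x y => hC.mem_iff_of_component z o hzo⟩
  have : {x | H.Reachable z x}ᶜ = {x | H.Reachable o x} := by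
    ext x; simp [hAB]
  rw [this]
  exact isLinked_of_reachable hHG o

/-! ### Chains and cocycles modulo 2 on triangulated discs. -/

section Disc

variable {V : Type*} [DecidableEq V] {𝒯 : Finset (Finset V)}

lemma IsTriangulatedDisc.exists_third (D : IsTriangulatedDisc 𝒯) {T : Finset V} (hT : T ∈ 𝒯)
    {a b : V} (ha : a ∈ T) (hb : b ∈ T) (hab : a ≠ b) :
    ∃ c, a ≠ c ∧ b ≠ c ∧ T = {a, b, c} := by
  have h3 := D.card_eq_three T hT
  have h1 : ((T.erase a).erase b).card = 1 := by
    rw [Finset.card_erase_of_mem (Finset.mem_erase.2 ⟨hab.symm, hb⟩),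
      Finset.card_erase_of_mem ha, h3]
  obtain ⟨c, hc⟩ := Finset.card_eq_one.1 h1
  have hc' : c ∈ (T.erase a).erase b := hc ▸ Finset.mem_singleton_self c
  simp only [Finset.mem_erase] at hc'
  refine ⟨c, hc'.2.1.symm, hc'.1.symm, ?_⟩
  rw [← hc, Finset.insert_erase (Finset.mem_erase.2 ⟨hab.symm, hb⟩), Finset.insert_erase ha]

lemma IsTriangulatedDisc.exists_others (D : IsTriangulatedDisc 𝒯) {T : Finset V} (hT : T ∈ 𝒯)
    {a : V} (ha : a ∈ T) : ∃ b c, a ≠ b ∧ a ≠ c ∧ b ≠ c ∧ T = {a, b, c} := by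
  obtain ⟨b, hb, hba⟩ := Finset.exists_mem_ne (by rw [D.card_eq_three T hT]; norm_num) a
  obtain ⟨c, h1, h2, h3⟩ := D.exists_third hT ha hb hba.symm
  exact ⟨b, c, hba.symm, h1, h2, h3⟩

/-- A property of the neighbours of `v` that spreads along the link of `v`. -/
lemma IsTriangulatedDisc.link_induction (D : IsTriangulatedDisc 𝒯) (v : V) (P : V → Prop)
    (hP : ∀ x y, v ≠ x → v ≠ y → x ≠ y → {v, x, y} ∈ 𝒯 → P x → P y)
    {x y : V} (hx : (skeleton 𝒯).Adj v x) (hPx : P x) (hy : (skeleton 𝒯).Adj v y) : P y :=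
  isLinked_univ_of_connected (D.link_connected v) (fun w => P w.1) ⟨x, hx⟩ trivial hPx
    (fun u _ w _ huw hu => hP u.1 w.1 u.2.1 w.2.1 (fun h => huw.1 (Subtype.ext h)) huw.2 hu)
    ⟨y, hy⟩ trivial

lemma IsTriangulatedDisc.numTriangles_eq (D : IsTriangulatedDisc 𝒯) {a b : V}
    (h : (skeleton 𝒯).Adj a b) :
    numTriangles 𝒯 a b = 1 ∨ numTriangles 𝒯 a b = 2 := by
  have h2 := D.numTriangles_le_two a b h.1
  obtain ⟨T, hT, ha, hb⟩ := h.2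
  have : 0 < numTriangles 𝒯 a b := Finset.card_pos.2 ⟨T, by simp [hT, ha, hb]⟩
  omega

lemma IsBoundaryEdge.adj {a b : V} (h : IsBoundaryEdge 𝒯 a b) : (skeleton 𝒯).Adj a b := by
  refine ⟨h.1, ?_⟩
  obtain ⟨T, hT⟩ := Finset.card_eq_one.1 h.2
  have : T ∈ 𝒯.filter fun T => a ∈ T ∧ b ∈ T := hT ▸ Finset.mem_singleton_self T
  rw [Finset.mem_filter] at this
  exact ⟨T, this⟩

lemma numTriangles_comm (a b : V) : numTriangles 𝒯 a b = numTriangles 𝒯 b a := by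
  unfold numTriangles; simp only [and_comm]

lemma IsBoundaryEdge.symm {a b : V} (h : IsBoundaryEdge 𝒯 a b) : IsBoundaryEdge 𝒯 b a :=
  ⟨h.1.symm, numTriangles_comm (𝒯 := 𝒯) a b ▸ h.2⟩

/-! ### Vanishing of chains -/

/-- If the boundary of a 2-chain `c` modulo 2 vanishes at the edge `a b`, and `c` vanishes at one
triangle at this edge, then it vanishes at all of them. -/
lemma IsTriangulatedDisc.chain_eq_zero_of_edge (D : IsTriangulatedDisc 𝒯) {c : Finset V → ZMod 2}
    {a b : V} (hab : a ≠ b) (h0 : ∑ T ∈ 𝒯 with a ∈ T ∧ b ∈ T, c T = 0)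
    {T₀ : Finset V} (hT₀ : T₀ ∈ 𝒯) (ha₀ : a ∈ T₀) (hb₀ : b ∈ T₀) (hc : c T₀ = 0)
    {T : Finset V} (hT : T ∈ 𝒯) (ha : a ∈ T) (hb : b ∈ T) : c T = 0 := by
  by_cases hTT : T = T₀
  · rw [hTT, hc]
  have hsub : ({T, T₀} : Finset (Finset V)) ⊆ 𝒯.filter fun T => a ∈ T ∧ b ∈ T := by
    intro S hS
    rcases Finset.mem_insert.1 hS with rfl | hS
    · simp [hT, ha, hb]
    · rw [Finset.mem_singleton.1 hS]; simp [hT₀, ha₀, hb₀]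
  have heq := Finset.eq_of_subset_of_card_le hsub
    (by rw [Finset.card_pair hTT]; exact D.numTriangles_le_two a b hab)
  rwa [← heq, Finset.sum_pair hTT, hc, add_zero] at h0

/-- An edge of the link of `v` is a triangle containing the spokes to both of its ends, so the edge
version carries vanishing from one spoke to the next, and the link is connected. -/
lemma IsTriangulatedDisc.chain_eq_zero_of_star (D : IsTriangulatedDisc 𝒯) {c : Finset V → ZMod 2}
    {v : V} (h0 : ∀ w, (skeleton 𝒯).Adj v w → ∑ T ∈ 𝒯 with v ∈ T ∧ w ∈ T, c T = 0)
    {T₀ : Finset V} (hT₀ : T₀ ∈ 𝒯) (hv₀ : v ∈ T₀) (hc : c T₀ = 0)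
    {T : Finset V} (hT : T ∈ 𝒯) (hv : v ∈ T) : c T = 0 := by
  obtain ⟨x, y, hvx, -, -, hT₀e⟩ := D.exists_others hT₀ hv₀
  obtain ⟨x', y', hvx', -, -, hTe⟩ := D.exists_others hT hv
  have hx : x ∈ T₀ := by simp [hT₀e]
  have hx' : x' ∈ T := by simp [hTe]
  refine D.link_induction v (fun w => ∀ S ∈ 𝒯, v ∈ S → w ∈ S → c S = 0) ?_
    (x := x) ⟨hvx, T₀, hT₀, hv₀, hx⟩ ?_ ⟨hvx', T, hT, hv, hx'⟩ T hT hv hx'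
  · intro p q hp hq _ hpq hzero S hS hvS hqS
    exact D.chain_eq_zero_of_edge hq (h0 q ⟨hq, _, hpq, by simp, by simp⟩) hpq (by simp) (by simp)
      (hzero _ hpq (by simp) (by simp)) hS hvS hqS
  · intro S hS hvS hxS
    exact D.chain_eq_zero_of_edge hvx (h0 x ⟨hvx, T₀, hT₀, hv₀, hx⟩) hT₀ hv₀ hx hc hS hvS hxS

lemma TriangulatedPolygon.skeleton_connected (Q : TriangulatedPolygon V) :
    Q.polyhedronSkeleton.Connected := by
  have : Nonempty (Option V) := ⟨none⟩
  let f : skeleton Q.triangles →g Q.polyhedronSkeleton :=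
    ⟨some, fun {a b} (h : (skeleton Q.triangles).Adj a b) => h⟩
  obtain ⟨v, hv⟩ := Q.isTriangulatedDisc.boundary_nonempty
  have hnv : Q.polyhedronSkeleton.Adj none (some v) := hv
  have key : ∀ x, Q.polyhedronSkeleton.Reachable none x := by
    rintro (_ | a)
    · exact SimpleGraph.Reachable.refl _
    · exact hnv.reachable.trans ((Q.isTriangulatedDisc.connected.preconnected v a).map f)
  exact ⟨fun x y => (key x).symm.trans (key y)⟩

/-- A 2-chain modulo 2 whose boundary is supported by edges inside `A` vanishes at the triangles
that meet the complement of `A`, if this complement together with `∞` is connected. -/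
lemma TriangulatedPolygon.chain_eq_zero (Q : TriangulatedPolygon V) {c : Finset V → ZMod 2}
    {A : Set V} (hA : IsLinked Q.polyhedronSkeleton (some '' A)ᶜ)
    (h0 : ∀ a b, (skeleton Q.triangles).Adj a b → ¬ (a ∈ A ∧ b ∈ A) →
      ∑ T ∈ Q.triangles with a ∈ T ∧ b ∈ T, c T = 0)
    {v : V} (hvA : v ∉ A) {T : Finset V} (hT : T ∈ Q.triangles) (hv : v ∈ T) : c T = 0 := by
  have D := Q.isTriangulatedDisc
  have hstar : ∀ w, w ∉ A → ∀ T₀ ∈ Q.triangles, w ∈ T₀ → c T₀ = 0 →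
      ∀ T ∈ Q.triangles, w ∈ T → c T = 0 := fun w hw T₀ hT₀ hw₀ hc T hT hwT =>
    D.chain_eq_zero_of_star (fun x hx => h0 w x hx fun h => hw h.1) hT₀ hw₀ hc hT hwT
  -- The property is vacuous at `∞` and spreads from there over the complement of `A`.
  refine hA (fun x => ∀ w, x = some w → ∀ T ∈ Q.triangles, w ∈ T → c T = 0) none (by simp)
    (by simp) ?_ (some v) (by simpa using hvA) v rfl T hT hv
  rintro x hx y hy hxy hPx w rfl
  have hw : w ∉ A := by simpa using hy
  cases x with
  | none =>
    obtain ⟨b, hb⟩ : IsBoundaryVertex Q.triangles w := hxy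
    -- A boundary edge lies in one triangle only, so the boundary of `c` at that edge is the value
    -- of `c` at this triangle.
    obtain ⟨T₀, hT₀⟩ := Finset.card_eq_one.1 hb.2
    have hmem : T₀ ∈ Q.triangles.filter fun T => w ∈ T ∧ b ∈ T :=
      hT₀ ▸ Finset.mem_singleton_self T₀
    have hs := h0 w b hb.adj fun h => hw h.1
    rw [hT₀, Finset.sum_singleton] at hs
    rw [Finset.mem_filter] at hmem
    exact hstar w hw T₀ hmem.1 hmem.2.1 hs
  | some u =>
    have huw : (skeleton Q.triangles).Adj u w := hxy
    obtain ⟨-, T₀, hT₀, hu₀, hw₀⟩ := huw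
    exact hstar w hw T₀ hT₀ hw₀ (hPx u rfl T₀ hT₀ hu₀)

/-! ### Cocycles -/

/-- Each generating move keeps the sum: an edge traversed back and forth counts twice, hence zero
modulo 2, and the triangle move is the cocycle condition. -/
lemma EdgeHomotopic.sum_eq {φ : Sym2 V → ZMod 2}
    (hφ : ∀ a b c, (skeleton 𝒯).Adj a b → (skeleton 𝒯).Adj b c → (skeleton 𝒯).Adj a c →
      {a, b, c} ∈ 𝒯 → φ s(a, b) + φ s(b, c) = φ s(a, c))
    {u v : V} {p q : (skeleton 𝒯).Walk u v} (h : EdgeHomotopic 𝒯 p q) :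
    (p.edges.map φ).sum = (q.edges.map φ).sum := by
  induction h with
  | refl p => rfl
  | symm _ ih => exact ih.symm
  | trans _ _ ih₁ ih₂ => exact ih₁.trans ih₂
  | cons h _ ih => simp [ih]
  | backtrack h p =>
    simp only [SimpleGraph.Walk.edges_cons, List.map_cons, List.sum_cons, Sym2.eq_swap, ← add_assoc]
    rw [CharTwo.add_self_eq_zero, zero_add]
  | triangle huv hvx hux hT p =>
    simp only [SimpleGraph.Walk.edges_cons, List.map_cons, List.sum_cons, ← add_assoc]
    rw [hφ _ _ _ huv hvx hux hT]

/-- Every 1-cocycle modulo 2 on a triangulated disc is a coboundary. -/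
lemma IsTriangulatedDisc.exists_potential (D : IsTriangulatedDisc 𝒯) {φ : Sym2 V → ZMod 2}
    (hφ : ∀ a b c, (skeleton 𝒯).Adj a b → (skeleton 𝒯).Adj b c → (skeleton 𝒯).Adj a c →
      {a, b, c} ∈ 𝒯 → φ s(a, b) + φ s(b, c) = φ s(a, c)) :
    ∃ g : V → ZMod 2, ∀ a b, (skeleton 𝒯).Adj a b → φ s(a, b) = g a + g b := by
  obtain ⟨o⟩ := D.connected.nonempty
  choose w _ using fun v => (D.connected.preconnected o v).elim (fun w => (⟨w, trivial⟩ :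
    ∃ _ : (skeleton 𝒯).Walk o v, True))
  -- The potential at `v` is the sum of `φ` along a chosen walk from `o`. The loop through `a`, `b`
  -- and back is null-homotopic, so its sum vanishes.
  refine ⟨fun v => ((w v).edges.map φ).sum, fun a b hab => ?_⟩
  have h := (D.simplyConnected o ((w a).append (.cons hab (w b).reverse))).sum_eq hφ
  simp only [SimpleGraph.Walk.edges_append, SimpleGraph.Walk.edges_cons,
    SimpleGraph.Walk.edges_reverse, List.map_append, List.map_cons, List.map_reverse,
    List.sum_append, List.sum_cons, List.sum_reverse, SimpleGraph.Walk.edges_nil, List.map_nil,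
    List.sum_nil] at h
  change φ s(a, b) = ((w a).edges.map φ).sum + ((w b).edges.map φ).sum
  generalize ((w a).edges.map φ).sum = x at *
  generalize ((w b).edges.map φ).sum = y at *
  generalize φ s(a, b) = t at *
  clear * - h
  revert x y t
  decide

end Disc

/-! ### Homology modulo 2 and the Euler characteristic of full subcomplexes. -/

section Euler

variable {V : Type*} [DecidableEq V]

/-- The triangles with all vertices in `A`. -/
def trianglesIn (𝒯 : Finset (Finset V)) (A : Finset V) : Finset (Finset V) :=
  𝒯.filter (· ⊆ A)

variable [Fintype V]

open scoped Classical in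
/-- The edges with both ends in `A`. -/
noncomputable def edgesIn (𝒯 : Finset (Finset V)) (A : Finset V) : Finset (Sym2 V) :=
  Finset.univ.filter fun e => e ∈ (skeleton 𝒯).edgeSet ∧ ∀ v ∈ e, v ∈ A

open scoped Classical in
/-- The boundary operator modulo 2 from edges to vertices, for the full subcomplex on `A`. -/
noncomputable def vertexEdgeMatrix (𝒯 : Finset (Finset V)) (A : Finset V) :
    Matrix A (edgesIn 𝒯 A) (ZMod 2) :=
  Matrix.of fun v e => if v.1 ∈ e.1 then 1 else 0

open scoped Classical in
/-- The boundary operator modulo 2 from triangles to edges, for the full subcomplex on `A`. -/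
noncomputable def edgeTriangleMatrix (𝒯 : Finset (Finset V)) (A : Finset V) :
    Matrix (edgesIn 𝒯 A) (trianglesIn 𝒯 A) (ZMod 2) :=
  Matrix.of fun e T => if ∀ v ∈ e.1, v ∈ T.1 then 1 else 0

variable {𝒯 : Finset (Finset V)} {A : Finset V}

lemma mem_edgesIn {a b : V} :
    s(a, b) ∈ edgesIn 𝒯 A ↔ (skeleton 𝒯).Adj a b ∧ a ∈ A ∧ b ∈ A := by
  simp [edgesIn]

omit [Fintype V] in
lemma mem_trianglesIn {T : Finset V} : T ∈ trianglesIn 𝒯 A ↔ T ∈ 𝒯 ∧ T ⊆ A := by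
  simp [trianglesIn]

lemma vertexEdgeMatrix_transpose_mulVec (g : A → ZMod 2) {a b : V}
    (h : s(a, b) ∈ edgesIn 𝒯 A) :
    ((vertexEdgeMatrix 𝒯 A).transpose.mulVec g) ⟨s(a, b), h⟩ =
      g ⟨a, (mem_edgesIn.1 h).2.1⟩ + g ⟨b, (mem_edgesIn.1 h).2.2⟩ := by
  have hab : a ≠ b := (mem_edgesIn.1 h).1.1
  have : ∀ v : A, (if v.1 ∈ s(a, b) then (1 : ZMod 2) else 0) * g v =
      (if v = ⟨a, (mem_edgesIn.1 h).2.1⟩ then g v else 0) +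
      (if v = ⟨b, (mem_edgesIn.1 h).2.2⟩ then g v else 0) := by
    rintro ⟨v, hv⟩
    simp only [Sym2.mem_iff, Subtype.mk.injEq]
    by_cases h1 : v = a
    · have : v ≠ b := h1 ▸ hab
      simp [h1, hab]
    · by_cases h2 : v = b
      · simp [h2, hab.symm]
      · simp [h1, h2]
  simp only [Matrix.mulVec, dotProduct, Matrix.transpose_apply, vertexEdgeMatrix, Matrix.of_apply]
  rw [Finset.sum_congr rfl fun v _ => this v, Finset.sum_add_distrib]
  simp

lemma mem_edgesIn_of_triangle {T : Finset V} (hT : T ∈ trianglesIn 𝒯 A) {a b : V} (hab : a ≠ b)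
    (ha : a ∈ T) (hb : b ∈ T) : s(a, b) ∈ edgesIn 𝒯 A :=
  mem_edgesIn.2 ⟨⟨hab, T, (mem_trianglesIn.1 hT).1, ha, hb⟩, (mem_trianglesIn.1 hT).2 ha,
    (mem_trianglesIn.1 hT).2 hb⟩

lemma edgeTriangleMatrix_transpose_mulVec (φ : edgesIn 𝒯 A → ZMod 2) {T : Finset V}
    (hT : T ∈ trianglesIn 𝒯 A) {a b c : V} (hab : a ≠ b) (hbc : b ≠ c) (hac : a ≠ c)
    (h : T = {a, b, c}) :
    ((edgeTriangleMatrix 𝒯 A).transpose.mulVec φ) ⟨T, hT⟩ =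
      φ ⟨s(a, b), mem_edgesIn_of_triangle hT hab (by simp [h]) (by simp [h])⟩ +
      φ ⟨s(b, c), mem_edgesIn_of_triangle hT hbc (by simp [h]) (by simp [h])⟩ +
      φ ⟨s(a, c), mem_edgesIn_of_triangle hT hac (by simp [h]) (by simp [h])⟩ := by
  classical
  have : ∀ e : edgesIn 𝒯 A, (if ∀ v ∈ e.1, v ∈ T then (1 : ZMod 2) else 0) * φ e =
      (if e = ⟨s(a, b), mem_edgesIn_of_triangle hT hab (by simp [h]) (by simp [h])⟩
        then φ e else 0) +
      (if e = ⟨s(b, c), mem_edgesIn_of_triangle hT hbc (by simp [h]) (by simp [h])⟩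
        then φ e else 0) +
      (if e = ⟨s(a, c), mem_edgesIn_of_triangle hT hac (by simp [h]) (by simp [h])⟩
        then φ e else 0) := by
    rintro ⟨e, he⟩
    induction e using Sym2.ind with | _ x y
    have hxy : x ≠ y := (mem_edgesIn.1 he).1.1
    simp only [Sym2.forall_mem_pair, Subtype.mk.injEq, Sym2.eq_iff, h, Finset.mem_insert,
      Finset.mem_singleton]
    generalize φ ⟨s(x, y), he⟩ = t
    by_cases h1 : x = a <;> by_cases h2 : x = b <;> by_cases h3 : x = c <;>
    by_cases h4 : y = a <;> by_cases h5 : y = b <;> by_cases h6 : y = c <;>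
    first
    | (exfalso; grind)
    | (subst_vars; simp_all)
  simp only [Matrix.mulVec, dotProduct, Matrix.transpose_apply, edgeTriangleMatrix, Matrix.of_apply]
  rw [Finset.sum_congr rfl fun v _ => this v, Finset.sum_add_distrib, Finset.sum_add_distrib]
  simp

/-- The coboundary of a coboundary adds up, over the three sides of a triangle, each vertex value
twice. -/
lemma IsTriangulatedDisc.edgeTriangleMatrix_transpose_mul (D : IsTriangulatedDisc 𝒯) :
    (edgeTriangleMatrix 𝒯 A).transpose * (vertexEdgeMatrix 𝒯 A).transpose = 0 := by
  apply Matrix.ext_of_mulVec_single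
  intro i
  rw [← Matrix.mulVec_mulVec, Matrix.zero_mulVec]
  generalize (Pi.single i 1 : A → ZMod 2) = g
  ext ⟨T, hT⟩
  obtain ⟨a, b, c, hab, hac, hbc, h⟩ := Finset.card_eq_three.1
    (D.card_eq_three T (mem_trianglesIn.1 hT).1)
  rw [edgeTriangleMatrix_transpose_mulVec _ hT hab hbc hac h]
  simp only [vertexEdgeMatrix_transpose_mulVec, Pi.zero_apply]
  generalize g _ = x
  generalize g _ = y
  generalize g _ = z
  revert x y z
  decide

lemma IsTriangulatedDisc.vertexEdgeMatrix_mul (D : IsTriangulatedDisc 𝒯) :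
    vertexEdgeMatrix 𝒯 A * edgeTriangleMatrix 𝒯 A = 0 := by
  rw [← Matrix.transpose_inj, Matrix.transpose_mul, D.edgeTriangleMatrix_transpose_mul,
    Matrix.transpose_zero]

/-- The kernel of the transpose consists of the functions that agree along edges, which are the
constants because `A` is linked. Rank-nullity and equality of row and column rank do the rest. -/
lemma rank_vertexEdgeMatrix (hne : A.Nonempty)
    (hA : IsLinked (skeleton 𝒯) (A : Set V)) :
    (vertexEdgeMatrix 𝒯 A).rank + 1 = A.card := by
  have hker : LinearMap.ker (vertexEdgeMatrix 𝒯 A).transpose.mulVecLin =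
      Submodule.span (ZMod 2) {(1 : A → ZMod 2)} := by
    apply le_antisymm
    · intro g hg
      obtain ⟨o, ho⟩ := hne
      rw [LinearMap.mem_ker, Matrix.mulVecLin_apply] at hg
      rw [Submodule.mem_span_singleton]
      refine ⟨g ⟨o, ho⟩, funext fun ⟨x, hx⟩ => ?_⟩
      have := hA (fun v => ∀ hv : v ∈ A, g ⟨v, hv⟩ = g ⟨o, ho⟩) o ho (fun _ => rfl)
        (fun x hx y hy hxy hgx hy' => ?_) x hx hx
      · simp [this]
      · have h := congrFun hg ⟨s(x, y), mem_edgesIn.2 ⟨hxy, hx, hy⟩⟩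
        rw [vertexEdgeMatrix_transpose_mulVec, Pi.zero_apply, hgx hx, CharTwo.add_eq_zero] at h
        exact h.symm
    · rw [Submodule.span_singleton_le_iff_mem, LinearMap.mem_ker, Matrix.mulVecLin_apply]
      ext ⟨e, he⟩
      induction e using Sym2.ind with | _ x y
      rw [vertexEdgeMatrix_transpose_mulVec]
      exact CharTwo.add_self_eq_zero _
  have h1 : Module.finrank (ZMod 2) (LinearMap.ker (vertexEdgeMatrix 𝒯 A).transpose.mulVecLin)
      = 1 := by
    rw [hker]
    obtain ⟨o, ho⟩ := hne
    exact finrank_span_singleton fun h => one_ne_zero (congrFun h ⟨o, ho⟩)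
  have h2 := LinearMap.finrank_range_add_finrank_ker (vertexEdgeMatrix 𝒯 A).transpose.mulVecLin
  rw [h1, Module.finrank_fintype_fun_eq_card, Fintype.card_coe] at h2
  rw [← Matrix.rank_transpose]
  exact h2

/-- The first homology modulo 2 of a triangulated disc vanishes. -/
lemma IsTriangulatedDisc.ker_eq_range (D : IsTriangulatedDisc 𝒯) :
    LinearMap.ker (vertexEdgeMatrix 𝒯 Finset.univ).mulVecLin =
      LinearMap.range (edgeTriangleMatrix 𝒯 Finset.univ).mulVecLin := by
  set M := vertexEdgeMatrix 𝒯 Finset.univ with hM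
  set N := edgeTriangleMatrix 𝒯 Finset.univ with hN
  -- Simple connectedness enters through cohomology; the statement for homology then follows by
  -- comparing ranks of matrices and their transposes.
  have hco : LinearMap.ker N.transpose.mulVecLin = LinearMap.range M.transpose.mulVecLin := by
    apply le_antisymm
    · intro φ hφ
      rw [LinearMap.mem_ker, Matrix.mulVecLin_apply] at hφ
      obtain ⟨g, hg⟩ := D.exists_potential
        (φ := fun e => if he : e ∈ edgesIn 𝒯 Finset.univ then φ ⟨e, he⟩ else 0) (by
          intro a b c hab hbc hac hT
          have hT' : ({a, b, c} : Finset V) ∈ trianglesIn 𝒯 Finset.univ := by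
            simp [mem_trianglesIn, hT]
          have := congrFun hφ ⟨_, hT'⟩
          rw [edgeTriangleMatrix_transpose_mulVec φ hT' hab.1 hbc.1 hac.1 rfl, Pi.zero_apply,
            CharTwo.add_eq_zero] at this
          have e1 : s(a, b) ∈ edgesIn 𝒯 Finset.univ := mem_edgesIn.2 ⟨hab, by simp, by simp⟩
          have e2 : s(b, c) ∈ edgesIn 𝒯 Finset.univ := mem_edgesIn.2 ⟨hbc, by simp, by simp⟩
          have e3 : s(a, c) ∈ edgesIn 𝒯 Finset.univ := mem_edgesIn.2 ⟨hac, by simp, by simp⟩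
          simp only [e1, e2, e3, dif_pos]
          exact this)
      refine ⟨fun v => g v, ?_⟩
      ext ⟨e, he⟩
      induction e using Sym2.ind with | _ x y
      rw [Matrix.mulVecLin_apply, vertexEdgeMatrix_transpose_mulVec]
      have := hg x y (mem_edgesIn.1 he).1
      rw [dif_pos he] at this
      exact this.symm
    · rintro _ ⟨g, rfl⟩
      rw [LinearMap.mem_ker, Matrix.mulVecLin_apply, Matrix.mulVecLin_apply,
        Matrix.mulVec_mulVec, D.edgeTriangleMatrix_transpose_mul, Matrix.zero_mulVec]
  symm
  apply Submodule.eq_of_le_of_finrank_eq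
  · rintro _ ⟨g, rfl⟩
    rw [LinearMap.mem_ker, Matrix.mulVecLin_apply, Matrix.mulVecLin_apply,
      Matrix.mulVec_mulVec, D.vertexEdgeMatrix_mul, Matrix.zero_mulVec]
  · have h1 := LinearMap.finrank_range_add_finrank_ker M.mulVecLin
    have h2 := LinearMap.finrank_range_add_finrank_ker N.transpose.mulVecLin
    rw [hco] at h2
    have h3 := Matrix.rank_transpose M
    have h4 := Matrix.rank_transpose N
    unfold Matrix.rank at h3 h4
    omega

/-- This compares the boundary operator of the subcomplex with that of the whole disc: a chain
supported in `A` has the same boundary in both. -/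
lemma edgeTriangleMatrix_mulVec {c : Finset V → ZMod 2} (hc : ∀ T ∈ 𝒯, ¬ T ⊆ A → c T = 0)
    {a b : V} (h : s(a, b) ∈ edgesIn 𝒯 A) :
    ((edgeTriangleMatrix 𝒯 A).mulVec fun T => c T) ⟨s(a, b), h⟩ =
      ∑ T ∈ 𝒯 with a ∈ T ∧ b ∈ T, c T := by
  simp only [Matrix.mulVec, dotProduct, edgeTriangleMatrix, Matrix.of_apply, Sym2.forall_mem_pair]
  rw [Finset.sum_coe_sort (trianglesIn 𝒯 A)
    (fun T => (if a ∈ T ∧ b ∈ T then (1 : ZMod 2) else 0) * c T), Finset.sum_filter]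
  simp only [ite_mul, one_mul, zero_mul]
  refine Finset.sum_subset (Finset.filter_subset _ _) fun T hT hTA => ?_
  rw [hc T hT fun h => hTA (mem_trianglesIn.2 ⟨hT, h⟩), ite_self]

lemma vertexEdgeMatrix_mulVec (z : Sym2 V → ZMod 2) (v : A) :
    ((vertexEdgeMatrix 𝒯 A).mulVec fun e => z e) v = ∑ e ∈ edgesIn 𝒯 A with v.1 ∈ e, z e := by
  simp only [Matrix.mulVec, dotProduct, vertexEdgeMatrix, Matrix.of_apply]
  rw [Finset.sum_coe_sort (edgesIn 𝒯 A)
    (fun e => (if v.1 ∈ e then (1 : ZMod 2) else 0) * z e), Finset.sum_filter]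
  simp only [ite_mul, one_mul, zero_mul]

namespace TriangulatedPolygon

variable (Q : TriangulatedPolygon V)

/-- There are no nonzero 2-cycles. Extended by zero, a 2-cycle is a cycle of the whole disc, and
`chain_eq_zero` with `∅` in place of `A` makes it vanish, starting from the boundary. -/
lemma edgeTriangleMatrix_ker :
    LinearMap.ker (edgeTriangleMatrix Q.triangles A).mulVecLin = ⊥ := by
  rw [LinearMap.ker_eq_bot']
  intro c hc
  rw [Matrix.mulVecLin_apply] at hc
  set c' : Finset V → ZMod 2 :=
    fun T => if h : T ∈ trianglesIn Q.triangles A then c ⟨T, h⟩ else 0 with hc'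
  have hoff : ∀ T ∈ Q.triangles, ¬ T ⊆ A → c' T = 0 := fun T _ h => by
    simp [hc', mem_trianglesIn, h]
  have hcc' : c = fun T => c' T.1 := by ext T; simp [hc']
  have key : ∀ a b, (skeleton Q.triangles).Adj a b →
      ∑ T ∈ Q.triangles with a ∈ T ∧ b ∈ T, c' T = 0 := by
    intro a b hab
    by_cases hA : a ∈ A ∧ b ∈ A
    · rw [← edgeTriangleMatrix_mulVec hoff (mem_edgesIn.2 ⟨hab, hA⟩), ← hcc', hc, Pi.zero_apply]
    · refine Finset.sum_eq_zero fun T hT => ?_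
      rw [Finset.mem_filter] at hT
      exact hoff T hT.1 fun h => hA ⟨h hT.2.1, h hT.2.2⟩
  ext ⟨T, hT⟩
  have hT1 := (mem_trianglesIn.1 hT).1
  obtain ⟨v, hv⟩ : T.Nonempty :=
    Finset.card_pos.1 (by rw [Q.isTriangulatedDisc.card_eq_three T hT1]; norm_num)
  have := Q.chain_eq_zero (c := c') (A := ∅)
    (by simpa using isLinked_univ_of_connected Q.skeleton_connected)
    (fun a b hab _ => key a b hab) (by simp) hT1 hv
  rw [hcc']
  exact this

/-- A 1-cycle in `A` bounds a chain in the disc. Since the boundary of this chain is supported in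
`A`, the chain vanishes at every triangle meeting the complement, so it already lies in the
subcomplex. -/
lemma ker_eq_range (hA : IsLinked Q.polyhedronSkeleton (some '' (A : Set V))ᶜ) :
    LinearMap.ker (vertexEdgeMatrix Q.triangles A).mulVecLin =
      LinearMap.range (edgeTriangleMatrix Q.triangles A).mulVecLin := by
  have D := Q.isTriangulatedDisc
  apply le_antisymm
  · intro z hz
    rw [LinearMap.mem_ker, Matrix.mulVecLin_apply] at hz
    set z' : Sym2 V → ZMod 2 :=
      fun e => if h : e ∈ edgesIn Q.triangles A then z ⟨e, h⟩ else 0 with hz'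
    have hzz' : z = fun e => z' e.1 := by ext e; simp [hz']
    have hcycle : (fun e => z' e.1) ∈
        LinearMap.ker (vertexEdgeMatrix Q.triangles Finset.univ).mulVecLin := by
      rw [LinearMap.mem_ker, Matrix.mulVecLin_apply]
      ext v
      have hsub : edgesIn Q.triangles A ⊆ edgesIn Q.triangles Finset.univ := by
        intro e he
        induction e using Sym2.ind with | _ x y
        exact mem_edgesIn.2 ⟨(mem_edgesIn.1 he).1, by simp, by simp⟩
      rw [vertexEdgeMatrix_mulVec, Pi.zero_apply,
        ← Finset.sum_subset (Finset.filter_subset_filter _ hsub) fun e he he' => by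
          have : e ∉ edgesIn Q.triangles A := fun h =>
            he' (Finset.mem_filter.2 ⟨h, (Finset.mem_filter.1 he).2⟩)
          simp [hz', this]]
      by_cases hv : v.1 ∈ A
      · rw [hzz'] at hz
        have := congrFun hz ⟨v.1, hv⟩
        rwa [vertexEdgeMatrix_mulVec] at this
      · refine Finset.sum_eq_zero fun e he => ?_
        rw [Finset.mem_filter] at he
        induction e using Sym2.ind with | _ x y
        have hxy := mem_edgesIn.1 he.1
        rcases Sym2.mem_iff.1 he.2 with h | h
        · exact absurd (h ▸ hxy.2.1) hv
        · exact absurd (h ▸ hxy.2.2) hv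
    rw [D.ker_eq_range] at hcycle
    obtain ⟨c, hc⟩ := hcycle
    set c' : Finset V → ZMod 2 :=
      fun T => if h : T ∈ trianglesIn Q.triangles Finset.univ then c ⟨T, h⟩ else 0 with hc'
    have hcc' : c = fun T => c' T.1 := by ext T; simp [hc']
    rw [Matrix.mulVecLin_apply, hcc'] at hc
    have hbd : ∀ a b, (skeleton Q.triangles).Adj a b →
        ∑ T ∈ Q.triangles with a ∈ T ∧ b ∈ T, c' T = z' s(a, b) := by
      intro a b hab
      have he : s(a, b) ∈ edgesIn Q.triangles Finset.univ := mem_edgesIn.2 ⟨hab, by simp, by simp⟩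
      have := congrFun hc ⟨_, he⟩
      rwa [edgeTriangleMatrix_mulVec (fun T _ h => absurd (Finset.subset_univ T) h)] at this
    have hoff : ∀ T ∈ Q.triangles, ¬ T ⊆ A → c' T = 0 := by
      intro T hT hTA
      obtain ⟨v, hv, hvA⟩ := Finset.not_subset.1 hTA
      refine Q.chain_eq_zero hA (fun a b hab hne => ?_) (by simpa using hvA) hT hv
      rw [hbd a b hab]
      have : s(a, b) ∉ edgesIn Q.triangles A := fun h => hne (mem_edgesIn.1 h).2
      simp [hz', this]
    refine ⟨fun T => c' T, ?_⟩
    rw [Matrix.mulVecLin_apply, hzz']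
    ext ⟨e, he⟩
    induction e using Sym2.ind with | _ x y
    rw [edgeTriangleMatrix_mulVec hoff, hbd x y (mem_edgesIn.1 he).1]
  · rintro _ ⟨g, rfl⟩
    rw [LinearMap.mem_ker, Matrix.mulVecLin_apply, Matrix.mulVecLin_apply,
      Matrix.mulVec_mulVec, D.vertexEdgeMatrix_mul, Matrix.zero_mulVec]

/-- The Euler characteristic of a full subcomplex is `1` if the subcomplex is connected and the
remaining vertices form, together with `∞`, a connected set. -/
lemma euler_characteristic (hne : A.Nonempty) (hA : IsLinked (skeleton Q.triangles) (A : Set V))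
    (hA' : IsLinked Q.polyhedronSkeleton (some '' (A : Set V))ᶜ) :
    A.card + (trianglesIn Q.triangles A).card = (edgesIn Q.triangles A).card + 1 := by
  -- The edge space has dimension rank plus nullity of the vertex-edge matrix. The rank is `A.card -
  -- 1`; the nullity is the number of triangles, since the edge-triangle matrix is injective with
  -- range this kernel.
  have h1 := LinearMap.finrank_range_add_finrank_ker
    (vertexEdgeMatrix Q.triangles A).mulVecLin
  have h2 := LinearMap.finrank_range_add_finrank_ker
    (edgeTriangleMatrix Q.triangles A).mulVecLin
  have h3 := rank_vertexEdgeMatrix hne hA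
  rw [Q.edgeTriangleMatrix_ker, finrank_bot, Module.finrank_fintype_fun_eq_card,
    Fintype.card_coe] at h2
  rw [Q.ker_eq_range hA', Module.finrank_fintype_fun_eq_card, Fintype.card_coe] at h1
  unfold Matrix.rank at h3
  omega

end TriangulatedPolygon

end Euler

/-! ### Counting the edges of the cut. -/

section Counting

variable {V : Type*} [DecidableEq V] [Fintype V] {𝒯 : Finset (Finset V)} {A : Finset V}

open scoped Classical in
/-- A vertex in the boundary has one neighbour more than triangles, and an interior vertex has as
many neighbours as triangles. -/
lemma IsTriangulatedDisc.card_neighbors (D : IsTriangulatedDisc 𝒯) (a : V) :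
    (Finset.univ.filter fun b => (skeleton 𝒯).Adj a b).card =
      (𝒯.filter fun T => a ∈ T).card + if IsBoundaryVertex 𝒯 a then 1 else 0 := by
  set N := Finset.univ.filter fun b => (skeleton 𝒯).Adj a b with hN
  -- Double counting: every triangle at `a` has two further vertices.
  have hsum : ∑ b ∈ N, numTriangles 𝒯 a b = 2 * (𝒯.filter fun T => a ∈ T).card := by
    have h1 : ∑ b ∈ N, numTriangles 𝒯 a b =
        ∑ b ∈ N, ((𝒯.filter fun T => a ∈ T).bipartiteAbove (fun b T => b ∈ T) b).card := by
      refine Finset.sum_congr rfl fun b _ => ?_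
      rw [Finset.bipartiteAbove, Finset.filter_filter, numTriangles]
    rw [h1, Finset.sum_card_bipartiteAbove_eq_sum_card_bipartiteBelow, mul_comm,
      Finset.sum_const_nat]
    intro T hT
    rw [Finset.mem_filter] at hT
    have : N.bipartiteBelow (fun b T => b ∈ T) T = T.erase a := by
      ext b
      simp only [Finset.bipartiteBelow, hN, Finset.mem_filter, Finset.mem_univ, true_and,
        Finset.mem_erase]
      exact ⟨fun h => ⟨h.1.1.symm, h.2⟩, fun h => ⟨⟨h.1.symm, T, hT.1, hT.2, h.2⟩, h.2⟩⟩
    rw [this, Finset.card_erase_of_mem hT.2, D.card_eq_three T hT.1]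
  -- The link is connected, so it has at most one vertex more than edges, and its edges inject into
  -- the triangles at `a`.
  have hle : N.card ≤ (𝒯.filter fun T => a ∈ T).card + 1 := by
    have h1 := (D.link_connected a).card_vert_le_card_edgeSet_add_one
    have h2 : Nat.card {w : V // (skeleton 𝒯).Adj a w} = N.card := by
      rw [Nat.card_eq_fintype_card, Fintype.card_subtype]
    rw [h2, Nat.card_eq_fintype_card, ← SimpleGraph.edgeFinset_card] at h1
    refine h1.trans (Nat.add_le_add_right ?_ 1)
    let f : Sym2 {w : V // (skeleton 𝒯).Adj a w} → Finset V := fun e =>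
      Sym2.lift ⟨fun x y => {a, x.1, y.1}, fun x y => congrArg (insert a) (Finset.pair_comm x.1 y.1)⟩ e
    refine Finset.card_le_card_of_injOn f ?_ ?_
    · intro e he
      induction e using Sym2.ind with | _ x y
      have : (link 𝒯 a).Adj x y := by simpa using he
      rw [Finset.mem_coe, Finset.mem_filter]
      exact ⟨this.2, Finset.mem_insert_self _ _⟩
    · intro e he e' he' hee
      induction e using Sym2.ind with | _ x y
      induction e' using Sym2.ind with | _ x' y'
      have hxy : (link 𝒯 a).Adj x y := by simpa using he
      have hxy' : (link 𝒯 a).Adj x' y' := by simpa using he'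
      have hee' : ({a, x.1, y.1} : Finset V) = {a, x'.1, y'.1} := hee
      have hx := x.2.1
      have hy := y.2.1
      have hx' := x'.2.1
      have hy' := y'.2.1
      have hne := hxy.1
      have hne' := hxy'.1
      have m1 : x.1 ∈ ({a, x'.1, y'.1} : Finset V) := hee' ▸ by simp
      have m2 : y.1 ∈ ({a, x'.1, y'.1} : Finset V) := hee' ▸ by simp
      simp only [Finset.mem_insert, Finset.mem_singleton] at m1 m2
      rw [Sym2.eq_iff]
      simp only [Subtype.ext_iff] at hne hne' ⊢
      grind
  by_cases hb : IsBoundaryVertex 𝒯 a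
  · rw [if_pos hb]
    -- A boundary edge makes the double count strict, so there are more neighbours than triangles;
    -- with `hle` the excess is exactly one.
    have hlt : ∑ b ∈ N, numTriangles 𝒯 a b < ∑ b ∈ N, 2 := by
      obtain ⟨b, hb⟩ := hb
      refine Finset.sum_lt_sum (fun w hw => ?_) ⟨b, by simp [hN, hb.adj], by rw [hb.2]; norm_num⟩
      exact D.numTriangles_le_two a w (Finset.mem_filter.1 hw).2.1
    rw [Finset.sum_const, smul_eq_mul] at hlt
    omega
  · rw [if_neg hb]
    have heq : ∑ b ∈ N, numTriangles 𝒯 a b = ∑ b ∈ N, 2 := by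
      refine Finset.sum_congr rfl fun w hw => ?_
      have hw := (Finset.mem_filter.1 hw).2
      exact (D.numTriangles_eq hw).resolve_left fun h => hb ⟨w, hw.1, h⟩
    rw [Finset.sum_const, smul_eq_mul] at heq
    omega

open scoped Classical in
/-- The ordered pairs of adjacent vertices with the first in `A` and the second outside. -/
noncomputable def crossPairs (𝒯 : Finset (Finset V)) (A : Finset V) : Finset (V × V) :=
  (A ×ˢ Aᶜ).filter fun x => (skeleton 𝒯).Adj x.1 x.2

open scoped Classical in
/-- The boundary vertices in `A`. -/
noncomputable def boundaryIn (𝒯 : Finset (Finset V)) (A : Finset V) : Finset V :=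
  A.filter fun a => IsBoundaryVertex 𝒯 a

lemma mem_crossPairs {a b : V} :
    (a, b) ∈ crossPairs 𝒯 A ↔ (skeleton 𝒯).Adj a b ∧ a ∈ A ∧ b ∉ A := by
  simp only [crossPairs, Finset.mem_filter, Finset.mem_product, Finset.mem_compl]
  tauto

open scoped Classical in
lemma card_product_filter_adj :
    ((A ×ˢ A).filter fun x => (skeleton 𝒯).Adj x.1 x.2).card = (edgesIn 𝒯 A).card * 2 := by
  rw [Finset.card_eq_sum_card_fiberwise (f := fun x : V × V => s(x.1, x.2)) (t := edgesIn 𝒯 A)]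
  · refine Finset.sum_const_nat fun e he => ?_
    induction e using Sym2.ind with | _ x y
    have h := mem_edgesIn.1 he
    have : (((A ×ˢ A).filter fun x => (skeleton 𝒯).Adj x.1 x.2).filter
        fun z : V × V => s(z.1, z.2) = s(x, y)) = {(x, y), (y, x)} := by
      ext ⟨p, q⟩
      simp only [Finset.mem_filter, Finset.mem_product, Sym2.eq_iff, Finset.mem_insert,
        Finset.mem_singleton, Prod.mk.injEq]
      constructor
      · exact fun h => h.2
      · rintro (⟨rfl, rfl⟩ | ⟨rfl, rfl⟩)
        · exact ⟨⟨h.2, h.1⟩, Or.inl ⟨rfl, rfl⟩⟩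
        · exact ⟨⟨h.2.symm, h.1.symm⟩, Or.inr ⟨rfl, rfl⟩⟩
    rw [this, Finset.card_pair fun h' => h.1.1 (Prod.mk.inj h').1]
  · rintro ⟨x, y⟩ h
    rw [Finset.mem_coe, Finset.mem_filter, Finset.mem_product] at h
    exact mem_edgesIn.2 ⟨h.2, h.1⟩

/-- Both sides are the sum of the degrees of the vertices in `A`. Edges inside `A` count twice and
leaving edges once; on the other side, `card_neighbors` trades neighbours for triangles. -/
lemma IsTriangulatedDisc.card_crossPairs (D : IsTriangulatedDisc 𝒯) :
    (crossPairs 𝒯 A).card + (edgesIn 𝒯 A).card * 2 =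
      ∑ T ∈ 𝒯, (A ∩ T).card + (boundaryIn 𝒯 A).card := by
  classical
  have h1 : ∑ a ∈ A, (Finset.univ.filter fun b => (skeleton 𝒯).Adj a b).card =
      (crossPairs 𝒯 A).card + (edgesIn 𝒯 A).card * 2 := by
    rw [← card_product_filter_adj, crossPairs, ← Finset.card_union_of_disjoint,
      ← Finset.filter_union, ← Finset.product_union, Finset.union_comm, Finset.union_compl]
    · rw [Finset.card_filter, Finset.sum_product]
      simp only [Finset.card_filter]
    · refine Finset.disjoint_left.2 fun x hx hx' => ?_
      rw [Finset.mem_filter, Finset.mem_product] at hx hx'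
      exact Finset.mem_compl.1 hx.1.2 hx'.1.2
  rw [← h1, Finset.sum_congr rfl fun a _ => D.card_neighbors a, Finset.sum_add_distrib,
    boundaryIn, Finset.card_filter]
  congr 1
  have := Finset.sum_card_bipartiteAbove_eq_sum_card_bipartiteBelow (s := A) (t := 𝒯)
    fun a T => a ∈ T
  simpa only [Finset.bipartiteAbove, Finset.bipartiteBelow, Finset.filter_mem_eq_inter] using this

/-- The number of edges that leave `A` in the polyhedron. -/
lemma TriangulatedPolygon.card_cut (Q : TriangulatedPolygon V) (hne : A.Nonempty)
    (hA : IsLinked (skeleton Q.triangles) (A : Set V))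
    (hA' : IsLinked Q.polyhedronSkeleton (some '' (A : Set V))ᶜ) :
    (crossPairs Q.triangles A).card + 2 * A.card + 2 * (trianglesIn Q.triangles A).card =
      ∑ T ∈ Q.triangles, (A ∩ T).card + (boundaryIn Q.triangles A).card + 2 := by
  have h1 := Q.euler_characteristic hne hA hA'
  have h2 := Q.isTriangulatedDisc.card_crossPairs (A := A)
  omega

end Counting

/-! ### Plane sectors and their angular measure. -/

section Plane

/-- The oriented area spanned by two plane vectors. -/
def cross (u w : ℂ) : ℝ := u.re * w.im - u.im * w.re

/-- The closed convex cone spanned by two plane vectors. -/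
def sector (u w : ℂ) : Set ℂ := {z | ∃ s t : ℝ, 0 ≤ s ∧ 0 ≤ t ∧ z = s * u + t * w}

/-- The unit vector in direction `φ`. -/
noncomputable def unitDir (φ : ℝ) : ℂ := ⟨Real.cos φ, Real.sin φ⟩

lemma sector_comm (u w : ℂ) : sector u w = sector w u := by
  ext z
  constructor <;> rintro ⟨s, t, hs, ht, rfl⟩ <;> exact ⟨t, s, ht, hs, by ring⟩

lemma cross_comm (u w : ℂ) : cross u w = -cross w u := by unfold cross; ring

lemma cross_lin_left (s t : ℝ) (u w z : ℂ) :
    cross (s * u + t * w) z = s * cross u z + t * cross w z := by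
  simp [cross]; ring

lemma cross_lin_right (s t : ℝ) (u w z : ℂ) :
    cross z (s * u + t * w) = s * cross z u + t * cross z w := by
  simp [cross]; ring

lemma cross_self (u : ℂ) : cross u u = 0 := by unfold cross; ring

lemma cross_smul_add (u w z : ℂ) :
    (cross u w : ℂ) * z = (cross z w : ℂ) * u + (cross u z : ℂ) * w := by
  apply Complex.ext <;> simp [cross] <;> ring

/-- By Cramer's rule (`cross_smul_add`) the coordinates of `z` are quotients by `cross u w`;
multiplying by its square gives signs that are independent of the orientation. -/
lemma mem_sector_iff {u w z : ℂ} (h : cross u w ≠ 0) :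
    z ∈ sector u w ↔ 0 ≤ cross z w * cross u w ∧ 0 ≤ cross u z * cross u w := by
  constructor
  · rintro ⟨s, t, hs, ht, rfl⟩
    rw [cross_lin_left, cross_lin_right, cross_self, cross_self]
    constructor
    · nlinarith [mul_nonneg hs (sq_nonneg (cross u w))]
    · nlinarith [mul_nonneg ht (sq_nonneg (cross u w))]
  · rintro ⟨h1, h2⟩
    have hpos : 0 < cross u w ^ 2 := by positivity
    refine ⟨cross z w / cross u w, cross u z / cross u w, ?_, ?_, ?_⟩
    · rw [show cross z w / cross u w = cross z w * cross u w / cross u w ^ 2 by field_simp]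
      positivity
    · rw [show cross u z / cross u w = cross u z * cross u w / cross u w ^ 2 by field_simp]
      positivity
    · have hc : (cross u w : ℂ) ≠ 0 := by exact_mod_cast h
      have := cross_smul_add u w z
      push_cast
      field_simp
      linear_combination this

@[fun_prop]
lemma continuous_cross {X : Type*} [TopologicalSpace X] {f g : X → ℂ} (hf : Continuous f)
    (hg : Continuous g) : Continuous fun x => cross (f x) (g x) := by
  unfold cross; fun_prop

@[fun_prop]
lemma continuous_unitDir : Continuous unitDir := by
  have : unitDir = fun φ => Complex.equivRealProdCLM.symm (Real.cos φ, Real.sin φ) := by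
    ext φ; rfl
  rw [this]; fun_prop

lemma isClosed_sector {u w : ℂ} (h : cross u w ≠ 0) : IsClosed (sector u w) := by
  have : sector u w = {z | 0 ≤ cross z w * cross u w} ∩ {z | 0 ≤ cross u z * cross u w} := by
    ext z; exact mem_sector_iff h
  rw [this]
  exact (isClosed_le (by fun_prop) (by fun_prop)).inter (isClosed_le (by fun_prop) (by fun_prop))

lemma mem_convexHull_triple {p u w x : ℂ} :
    x ∈ convexHull ℝ ({p, p + u, p + w} : Set ℂ) ↔
      ∃ s t : ℝ, 0 ≤ s ∧ 0 ≤ t ∧ s + t ≤ 1 ∧ x = p + (s * u + t * w) := by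
  constructor
  · rw [convexHull_insert (by simp), convexHull_pair, convexJoin_singleton_left]
    simp only [Set.mem_iUnion, segment, exists_prop, Set.mem_ofPred_eq, Complex.real_smul]
    rintro ⟨_, ⟨a, b, ha, hb, hab, rfl⟩, c, d, hc, hd, hcd, rfl⟩
    refine ⟨d * a, d * b, by positivity, by positivity, by nlinarith, ?_⟩
    have h1 : (a : ℂ) + b = 1 := by exact_mod_cast hab
    have h2 : (c : ℂ) + d = 1 := by exact_mod_cast hcd
    push_cast
    linear_combination (p * h2 + d * p * h1)
  · rintro ⟨s, t, hs, ht, hst, rfl⟩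
    have hc := convex_convexHull ℝ ({p, p + u, p + w} : Set ℂ)
    have hsub := subset_convexHull ℝ ({p, p + u, p + w} : Set ℂ)
    have := hc.sum_mem (t := Finset.univ) (w := ![1 - s - t, s, t]) (z := ![p, p + u, p + w])
      (by intro i _; fin_cases i <;> simp <;> linarith) (by simp [Fin.sum_univ_three]; ring)
      (by intro i _; fin_cases i <;> exact hsub (by simp))
    convert this using 1
    simp [Fin.sum_univ_three]
    ring

lemma mem_sector_of_mem_hull {p u w z : ℂ} {s : ℝ} (hs : 0 < s)
    (h : p + s * z ∈ convexHull ℝ ({p, p + u, p + w} : Set ℂ)) : z ∈ sector u w := by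
  obtain ⟨a, b, ha, hb, -, he⟩ := mem_convexHull_triple.1 h
  refine ⟨a / s, b / s, by positivity, by positivity, ?_⟩
  have hs' : (s : ℂ) ≠ 0 := by exact_mod_cast hs.ne'
  push_cast
  field_simp
  rw [mul_comm]
  exact add_left_cancel he

lemma eventually_mem_hull {p u w z : ℂ} (h : z ∈ sector u w) :
    ∀ᶠ s : ℝ in 𝓝[>] 0, p + s * z ∈ convexHull ℝ ({p, p + u, p + w} : Set ℂ) := by
  obtain ⟨a, b, ha, hb, rfl⟩ := h
  have h1 : ∀ᶠ s : ℝ in 𝓝[>] 0, s * (a + b) < 1 := by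
    have : Tendsto (fun s : ℝ => s * (a + b)) (𝓝[>] 0) (𝓝 (0 * (a + b))) :=
      ((continuous_id.mul continuous_const).tendsto 0).mono_left nhdsWithin_le_nhds
    exact this.eventually_lt_const (by simp)
  filter_upwards [h1, self_mem_nhdsWithin] with s hs hs0
  have hs0 : 0 < s := hs0
  refine mem_convexHull_triple.2 ⟨s * a, s * b, by positivity, by positivity, by linarith, ?_⟩
  push_cast; ring

/-! ### The angular measure of a sector -/

/-- The directions in `[-π, π]` that point into a set of plane vectors. -/
noncomputable def directions (S : Set ℂ) : Set ℝ :=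
  {φ | φ ∈ Set.Icc (-Real.pi) Real.pi ∧ unitDir φ ∈ S}

lemma unitDir_add (φ ψ : ℝ) : unitDir (φ + ψ) = unitDir φ * unitDir ψ := by
  apply Complex.ext
  · simp [unitDir, Real.cos_add]
  · simp [unitDir, Real.sin_add]; ring

lemma unitDir_add_zsmul (φ : ℝ) (n : ℤ) : unitDir (n • (2 * Real.pi) + φ) = unitDir φ := by
  apply Complex.ext <;> simp [unitDir, add_comm]

/-- Rotation translates the angles, and any two half-open intervals of length `2π` are fundamental
domains for the same periodic set. -/
lemma volume_directions_rotate {S : Set ℂ} (hS : MeasurableSet S) (β : ℝ) :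
    volume (directions {z | z * unitDir β ∈ S}) = volume (directions S) := by
  have hIoc : ∀ S : Set ℂ, volume (directions S) =
      volume ({φ | unitDir φ ∈ S} ∩ Set.Ioc (-Real.pi) Real.pi) := by
    intro S
    apply measure_congr
    have : (Set.Ioc (-Real.pi) Real.pi : Set ℝ) =ᵐ[volume] Set.Icc (-Real.pi) Real.pi :=
      Ioc_ae_eq_Icc
    have h2 : directions S = {φ | unitDir φ ∈ S} ∩ Set.Icc (-Real.pi) Real.pi := by
      ext φ; exact and_comm
    rw [h2]
    exact (ae_eq_refl _).inter this.symm
  rw [hIoc, hIoc]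
  have hmeas : MeasurableSet {φ | unitDir φ ∈ S} := continuous_unitDir.measurable hS
  have h1 : {φ | unitDir φ ∈ {z | z * unitDir β ∈ S}} ∩ Set.Ioc (-Real.pi) Real.pi =
      (fun φ => φ + β) ⁻¹' ({φ | unitDir φ ∈ S} ∩ Set.Ioc (-Real.pi + β) (-Real.pi + β + 2 * Real.pi)) := by
    ext φ
    simp only [Set.mem_inter_iff, Set.mem_ofPred_eq, Set.mem_preimage, Set.mem_Ioc, unitDir_add]
    refine and_congr_right fun _ => ⟨fun h => ⟨by linarith [h.1], by linarith [h.2]⟩,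
      fun h => ⟨by linarith [h.1], by linarith [h.2]⟩⟩
  rw [h1, measure_preimage_add_right]
  have h2 : Set.Ioc (-Real.pi) Real.pi = Set.Ioc (-Real.pi) (-Real.pi + 2 * Real.pi) := by
    congr 1; ring
  rw [h2]
  refine (isAddFundamentalDomain_Ioc Real.two_pi_pos (-Real.pi + β)).measure_set_eq
    (isAddFundamentalDomain_Ioc Real.two_pi_pos (-Real.pi)) hmeas ?_
  rintro ⟨g, hg⟩
  obtain ⟨n, rfl⟩ := AddSubgroup.mem_zmultiples_iff.1 hg
  ext φ
  simp only [Set.mem_preimage, Set.mem_ofPred_eq]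
  change unitDir (n • (2 * Real.pi) + φ) ∈ S ↔ _
  rw [unitDir_add_zsmul]

/-- The angles in `[-π, π]` with `0 ≤ sin ψ` and `0 ≤ sin (γ - ψ)`. -/
lemma sin_nonneg_and_iff {γ ψ : ℝ} (h0 : 0 < γ) (hpi : γ < Real.pi) (h1 : -Real.pi ≤ ψ)
    (h2 : ψ ≤ Real.pi) :
    (0 ≤ Real.sin ψ ∧ 0 ≤ Real.sin (γ - ψ)) ↔ 0 ≤ ψ ∧ ψ ≤ γ := by
  constructor
  · rintro ⟨h3, h4⟩
    have hψ : 0 ≤ ψ := by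
      by_contra! hneg
      rcases h1.eq_or_lt with h | h
      -- The endpoint `-π` satisfies the first inequality, and only the second one excludes it.
      · rw [← h, sub_neg_eq_add, Real.sin_add_pi] at h4
        linarith [Real.sin_pos_of_pos_of_lt_pi h0 hpi]
      · linarith [Real.sin_neg_of_neg_of_neg_pi_lt hneg h]
    refine ⟨hψ, ?_⟩
    by_contra! hgt
    linarith [Real.sin_neg_of_neg_of_neg_pi_lt (x := γ - ψ) (by linarith) (by linarith)]
  · rintro ⟨h3, h4⟩
    exact ⟨Real.sin_nonneg_of_nonneg_of_le_pi h3 h2,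
      Real.sin_nonneg_of_nonneg_of_le_pi (by linarith) (by linarith)⟩

lemma sector_smul {a b : ℝ} (ha : 0 < a) (hb : 0 < b) (u w : ℂ) :
    sector (a * u) (b * w) = sector u w := by
  ext z
  constructor
  · rintro ⟨s, t, hs, ht, rfl⟩
    exact ⟨s * a, t * b, by positivity, by positivity, by push_cast; ring⟩
  · rintro ⟨s, t, hs, ht, rfl⟩
    have ha' : (a : ℂ) ≠ 0 := by exact_mod_cast ha.ne'
    have hb' : (b : ℂ) ≠ 0 := by exact_mod_cast hb.ne'
    exact ⟨s / a, t / b, by positivity, by positivity, by push_cast; field_simp⟩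

lemma eq_norm_mul_unitDir (z : ℂ) : z = ‖z‖ * unitDir z.arg := by
  conv_lhs => rw [← Complex.norm_mul_cos_add_sin_mul_I z]
  congr 1
  apply Complex.ext <;> simp [unitDir, Complex.cos_ofReal_re, Complex.sin_ofReal_re]

lemma sector_unitDir {α : ℝ} (h0 : 0 < α) (hpi : α < Real.pi) :
    directions (sector 1 (unitDir α)) = Set.Icc 0 α := by
  have hs := Real.sin_pos_of_pos_of_lt_pi h0 hpi
  have hc : cross 1 (unitDir α) = Real.sin α := by simp [cross, unitDir]
  ext φ
  simp only [directions, Set.mem_ofPred_eq, mem_sector_iff (hc ▸ hs.ne' : cross 1 (unitDir α) ≠ 0), hc]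
  have e1 : cross (unitDir φ) (unitDir α) = Real.sin (α - φ) := by
    simp [cross, unitDir, Real.sin_sub]; ring
  have e2 : cross 1 (unitDir φ) = Real.sin φ := by simp [cross, unitDir]
  rw [e1, e2, mul_nonneg_iff_of_pos_right hs, mul_nonneg_iff_of_pos_right hs]
  constructor
  · rintro ⟨⟨h1, h2⟩, h3, h4⟩
    exact (sin_nonneg_and_iff h0 hpi h1 h2).1 ⟨h4, h3⟩
  · rintro ⟨h1, h2⟩
    have h3 : -Real.pi ≤ φ := by linarith [Real.pi_pos]
    have h4 : φ ≤ Real.pi := by linarith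
    exact ⟨⟨h3, h4⟩, ((sin_nonneg_and_iff h0 hpi h3 h4).2 ⟨h1, h2⟩).symm⟩

lemma cross_ne_zero_left {u w : ℂ} (h : cross u w ≠ 0) : u ≠ 0 := by
  rintro rfl; simp [cross] at h

lemma cross_ne_zero_right {u w : ℂ} (h : cross u w ≠ 0) : w ≠ 0 := by
  rintro rfl; simp [cross] at h

lemma norm_unitDir (φ : ℝ) : ‖unitDir φ‖ = 1 := by
  rw [← sq_eq_sq₀ (norm_nonneg _) zero_le_one, ← Complex.normSq_eq_norm_sq, Complex.normSq_apply]
  simp only [unitDir]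
  nlinarith [Real.sin_sq_add_cos_sq φ]

lemma arg_div_eq {u w : ℂ} (h : cross u w ≠ 0) :
    0 < |(w / u).arg| ∧ |(w / u).arg| < Real.pi := by
  have him : (w / u).im = cross u w / Complex.normSq u := by
    rw [Complex.div_im]; unfold cross; ring
  have hu := cross_ne_zero_left h
  have hne : (w / u).im ≠ 0 := by
    rw [him]; exact div_ne_zero h (by simpa using hu)
  refine ⟨abs_pos.2 fun h0 => hne (Complex.arg_eq_zero_iff.1 h0).2,
    lt_of_le_of_ne (Complex.abs_arg_le_pi _) fun hp => ?_⟩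
  rcases abs_eq Real.pi_pos.le |>.1 hp with h1 | h1
  · exact hne (Complex.arg_eq_pi_iff.1 h1).2
  · linarith [Complex.neg_pi_lt_arg (w / u)]

/-- A rotation by `u.arg` reduces this to the sector between `1` and `unitDir (w / u).arg`, whose
directions are an explicit interval. -/
lemma volume_directions_sector_of_pos {u w : ℂ} (h : cross u w ≠ 0) (hpos : 0 < (w / u).arg) :
    volume (directions (sector u w)) = ENNReal.ofReal (w / u).arg := by
  have hu := cross_ne_zero_left h
  have hw := cross_ne_zero_right h
  rw [← volume_directions_rotate (isClosed_sector h).measurableSet u.arg]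
  have hset : {z | z * unitDir u.arg ∈ sector u w} = sector 1 (unitDir (w / u).arg) := by
    have hζ : unitDir u.arg ≠ 0 := by
      rw [← norm_pos_iff, norm_unitDir]; exact one_pos
    have hw' : w = ‖w‖ * (unitDir (w / u).arg * unitDir u.arg) := by
      have h1 := eq_norm_mul_unitDir (w / u)
      have h2 := eq_norm_mul_unitDir u
      have h3 : w = (w / u) * u := by field_simp
      rw [norm_div] at h1
      have h4 : ((‖u‖ : ℝ) : ℂ) ≠ 0 := by exact_mod_cast (norm_pos_iff.2 hu).ne'
      calc w = (w / u) * u := h3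
        _ = (((‖w‖ / ‖u‖ : ℝ) : ℂ) * unitDir (w / u).arg) * (‖u‖ * unitDir u.arg) := by
          rw [← h1, ← h2]
        _ = _ := by push_cast; field_simp
    have e1 : sector u w = sector (1 * unitDir u.arg) (unitDir (w / u).arg * unitDir u.arg) := by
      conv_lhs => rw [eq_norm_mul_unitDir u, hw']
      rw [sector_smul (norm_pos_iff.2 hu) (norm_pos_iff.2 hw), one_mul]
    rw [e1]
    ext z
    constructor
    · rintro ⟨s, t, hs, ht, he⟩
      exact ⟨s, t, hs, ht, mul_right_cancel₀ hζ (by rw [he]; ring)⟩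
    · rintro ⟨s, t, hs, ht, rfl⟩
      exact ⟨s, t, hs, ht, by ring⟩
  have hlt := (arg_div_eq h).2
  rw [abs_of_pos hpos] at hlt
  rw [hset, sector_unitDir hpos hlt, Real.volume_Icc, sub_zero]

lemma volume_directions_sector {u w : ℂ} (h : cross u w ≠ 0) :
    volume (directions (sector u w)) = ENNReal.ofReal (InnerProductGeometry.angle u w) := by
  have hu := cross_ne_zero_left h
  have hw := cross_ne_zero_right h
  rcases lt_or_ge 0 (w / u).arg with hp | hn
  · rw [volume_directions_sector_of_pos h hp, InnerProductGeometry.angle_comm,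
      Complex.angle_eq_abs_arg hw hu, abs_of_pos hp]
  · have h' : cross w u ≠ 0 := by rw [cross_comm]; exact neg_ne_zero.2 h
    have hlt := arg_div_eq h
    have harg : (u / w).arg = -(w / u).arg := by
      rw [← inv_div, Complex.arg_inv, if_neg]
      intro hpi; rw [hpi, abs_of_pos Real.pi_pos] at hlt; exact lt_irrefl _ hlt.2
    have hn' : (w / u).arg < 0 := lt_of_le_of_ne hn fun h0 => by simp [h0] at hlt
    rw [sector_comm, volume_directions_sector_of_pos h' (by rw [harg]; linarith),
      Complex.angle_eq_abs_arg hu hw, harg, abs_of_pos (by linarith)]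

/-- At most two angles qualify: `u.arg`, and `-π`, which is listed separately because `Complex.arg`
takes values in `(-π, π]`. -/
lemma volume_directions_ray {u : ℂ} :
    volume (directions {z | ∃ t : ℝ, 0 ≤ t ∧ z = t * u}) = 0 := by
  refine measure_mono_null (t := {u.arg, -Real.pi}) ?_ (Set.Finite.measure_zero (by simp) _)
  rintro φ ⟨⟨h1, h2⟩, t, ht, he⟩
  rcases h1.eq_or_lt with h | h
  · exact Or.inr h.symm
  · left
    have ht' : 0 < t := lt_of_le_of_ne ht fun h0 => by
      have := norm_unitDir φ
      rw [he, ← h0] at this; simp at this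
    have : φ = (unitDir φ).arg := by
      have := Complex.arg_mul_cos_add_sin_mul_I one_pos ⟨h, h2⟩
      refine this.symm.trans (congrArg Complex.arg ?_)
      apply Complex.ext <;> simp [unitDir, Complex.cos_ofReal_re, Complex.sin_ofReal_re]
    rw [this, he, Complex.arg_real_mul _ ht']

end Plane

/-! ### Triangle angles and the dihedral angles at vertical edges. -/

namespace TriangulatedPolygon

variable {V : Type*} [DecidableEq V] (Q : TriangulatedPolygon V)

lemma cross_ne_zero {a b c : V} (hT : {a, b, c} ∈ Q.triangles) (hab : a ≠ b) (hac : a ≠ c)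
    (hbc : b ≠ c) : cross (Q.pos b - Q.pos a) (Q.pos c - Q.pos a) ≠ 0 := by
  have hai := Q.nondegenerate _ hT
  have hinj : Function.Injective (![⟨a, by simp⟩, ⟨b, by simp⟩, ⟨c, by simp⟩] :
      Fin 3 → ({a, b, c} : Finset V)) := by
    intro i j hij
    have h := congrArg Subtype.val hij
    fin_cases i <;> fin_cases j <;> first
      | rfl
      | exact absurd h hab
      | exact absurd h hac
      | exact absurd h hbc
      | exact absurd h hab.symm
      | exact absurd h hac.symm
      | exact absurd h hbc.symm
  have h3 := hai.comp_embedding ⟨_, hinj⟩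
  rw [affineIndependent_iff] at h3
  intro hcr
  have key : ∀ s t : ℝ, (s : ℂ) * (Q.pos b - Q.pos a) + t * (Q.pos c - Q.pos a) = 0 →
      s = 0 ∧ t = 0 := by
    intro s t hst
    have := h3 Finset.univ ![-s - t, s, t] (by simp [Fin.sum_univ_three]; ring) (by
      simp [Fin.sum_univ_three]
      linear_combination hst)
    exact ⟨by simpa using this 1 (by simp), by simpa using this 2 (by simp)⟩
  set u := Q.pos b - Q.pos a
  set w := Q.pos c - Q.pos a
  unfold cross at hcr
  -- If the cross product vanishes, these two linear relations between `u` and `w` hold;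
  -- independence then kills their coefficients and gives `u = 0`.
  have h1 := key w.re (-u.re) (by apply Complex.ext <;> simp <;> linarith)
  have h2 := key w.im (-u.im) (by apply Complex.ext <;> simp <;> linarith)
  have hu : u = 0 := Complex.ext (by simpa using h1.2) (by simpa using h2.2)
  exact one_ne_zero (key 1 0 (by simp [hu])).1

/-- The cone of directions at the vertex `v` that point into the triangle `T`. -/
def cone (T : Finset V) (v : V) : Set ℂ :=
  {z | ∀ᶠ s : ℝ in 𝓝[>] 0, Q.pos v + s * z ∈ convexHull ℝ (Q.pos '' (T : Set V))}

/-- The angle of the triangle `T` at its vertex `v`. -/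
noncomputable def angleAt (T : Finset V) (v : V) : ℝ :=
  (volume (directions (Q.cone T v))).toReal

lemma image_triple (a b c : V) : Q.pos '' (({a, b, c} : Finset V) : Set V) =
    {Q.pos a, Q.pos a + (Q.pos b - Q.pos a), Q.pos a + (Q.pos c - Q.pos a)} := by
  simp [Set.image_insert_eq]

lemma mem_sector_of_mem {a b c : V} {z : ℂ} {s : ℝ} (hs : 0 < s)
    (h : Q.pos a + s * z ∈ convexHull ℝ (Q.pos '' (({a, b, c} : Finset V) : Set V))) :
    z ∈ sector (Q.pos b - Q.pos a) (Q.pos c - Q.pos a) := by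
  rw [image_triple] at h
  exact mem_sector_of_mem_hull hs h

lemma cone_eq_sector (a b c : V) :
    Q.cone {a, b, c} a = sector (Q.pos b - Q.pos a) (Q.pos c - Q.pos a) := by
  ext z
  constructor
  · intro h
    rw [cone, Set.mem_ofPred_eq] at h
    obtain ⟨s, hs, hs0⟩ := (h.and self_mem_nhdsWithin).exists
    exact Q.mem_sector_of_mem hs0 hs
  · intro h
    have := eventually_mem_hull (p := Q.pos a) h
    rwa [← image_triple] at this

lemma angleAt_eq {a b c : V} (hT : {a, b, c} ∈ Q.triangles) (hab : a ≠ b) (hac : a ≠ c)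
    (hbc : b ≠ c) :
    Q.angleAt {a, b, c} a = InnerProductGeometry.angle (Q.pos b - Q.pos a) (Q.pos c - Q.pos a) := by
  rw [angleAt, cone_eq_sector, volume_directions_sector (Q.cross_ne_zero hT hab hac hbc),
    ENNReal.toReal_ofReal (InnerProductGeometry.angle_nonneg _ _)]

lemma angle_pos {u w : ℂ} (h : cross u w ≠ 0) : 0 < InnerProductGeometry.angle u w := by
  rw [InnerProductGeometry.angle_comm,
    Complex.angle_eq_abs_arg (cross_ne_zero_right h) (cross_ne_zero_left h)]
  exact (arg_div_eq h).1

lemma angleAt_pos {T : Finset V} (hT : T ∈ Q.triangles) {a : V} (ha : a ∈ T) :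
    0 < Q.angleAt T a := by
  obtain ⟨b, c, hab, hac, hbc, rfl⟩ := Q.isTriangulatedDisc.exists_others hT ha
  rw [Q.angleAt_eq hT hab hac hbc]
  exact angle_pos (Q.cross_ne_zero hT hab hac hbc)

lemma rotate_triple (a b c : V) : ({a, b, c} : Finset V) = {b, c, a} := by
  ext; simp; tauto

lemma angleAt_add {a b c : V} (hT : {a, b, c} ∈ Q.triangles) (hab : a ≠ b) (hac : a ≠ c)
    (hbc : b ≠ c) :
    Q.angleAt {a, b, c} a + Q.angleAt {a, b, c} b + Q.angleAt {a, b, c} c = Real.pi := by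
  have hT2 : ({b, c, a} : Finset V) ∈ Q.triangles := rotate_triple a b c ▸ hT
  have hT3 : ({c, a, b} : Finset V) ∈ Q.triangles := rotate_triple b c a ▸ hT2
  have hne : Q.pos b ≠ Q.pos a := fun h => cross_ne_zero_left (Q.cross_ne_zero hT hab hac hbc)
    (sub_eq_zero.2 h)
  have := EuclideanGeometry.angle_add_angle_add_angle_eq_pi (Q.pos c) hne
  rw [Q.angleAt_eq hT hab hac hbc, rotate_triple a b c, Q.angleAt_eq hT2 hbc hab.symm hac.symm,
    rotate_triple b c a, Q.angleAt_eq hT3 hac.symm hbc.symm hab]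
  simp only [EuclideanGeometry.angle, vsub_eq_sub] at this
  rw [InnerProductGeometry.angle_comm (Q.pos c - Q.pos b),
    InnerProductGeometry.angle_comm (Q.pos b - Q.pos a),
    InnerProductGeometry.angle_comm (Q.pos a - Q.pos c)]
  linarith

lemma sum_angleAt {T : Finset V} (hT : T ∈ Q.triangles) : ∑ v ∈ T, Q.angleAt T v = Real.pi := by
  obtain ⟨a, b, c, hab, hac, hbc, rfl⟩ := Finset.card_eq_three.1
    (Q.isTriangulatedDisc.card_eq_three T hT)
  rw [Finset.sum_insert (by simp [hab, hac]), Finset.sum_pair hbc, ← add_assoc,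
    Q.angleAt_add hT hab hac hbc]

/-! ### Triangles with a common vertex -/

/-- A small step from `v` in direction `z` stays in both triangles, hence by the immersion condition
in their common face, which is contained in the segment from `v` to `b`. -/
lemma exists_ray {T T' : Finset V} (hT : T ∈ Q.triangles) (hT' : T' ∈ Q.triangles) {v b : V}
    (hv : v ∈ T) (hv' : v ∈ T') (hb : T ∩ T' ⊆ {v, b}) {z : ℂ} (hz : z ∈ Q.cone T v)
    (hz' : z ∈ Q.cone T' v) : ∃ t : ℝ, 0 ≤ t ∧ z = t * (Q.pos b - Q.pos v) := by
  rw [cone, Set.mem_ofPred_eq] at hz hz'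
  obtain ⟨s, ⟨h1, h2⟩, hs0⟩ := ((hz.and hz').and self_mem_nhdsWithin).exists
  have h3 := Q.immersed T hT T' hT' ⟨v, by simp [hv, hv']⟩ ⟨h1, h2⟩
  have hsub : Q.pos '' ((T ∩ T' : Finset V) : Set V) ⊆
      -- The segment is treated as a degenerate triangle, whose sector is a ray.
      Q.pos '' (({v, b, b} : Finset V) : Set V) := by
    apply Set.image_mono
    intro x hx
    have := hb hx
    simpa using this
  obtain ⟨p, q, hp, hq, rfl⟩ := Q.mem_sector_of_mem hs0 (convexHull_mono hsub h3)
  exact ⟨p + q, by positivity, by push_cast; ring⟩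

lemma exists_inter_subset {T T' : Finset V} (hT : T ∈ Q.triangles) (hT' : T' ∈ Q.triangles)
    (hne : T ≠ T') {v : V} (hv : v ∈ T) (hv' : v ∈ T') : ∃ b, T ∩ T' ⊆ {v, b} := by
  obtain ⟨b, c, -, -, -, rfl⟩ := Q.isTriangulatedDisc.exists_others hT hv
  by_cases hb : b ∈ T'
  · refine ⟨b, fun x hx => ?_⟩
    simp only [Finset.mem_inter, Finset.mem_insert, Finset.mem_singleton] at hx ⊢
    rcases hx.1 with h | h | rfl
    · exact Or.inl h
    · exact Or.inr h
    · exfalso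
      apply hne
      refine Finset.eq_of_subset_of_card_le ?_ ?_
      · intro y hy
        simp only [Finset.mem_insert, Finset.mem_singleton] at hy
        rcases hy with rfl | rfl | rfl
        exacts [hv', hb, hx.2]
      · rw [Q.isTriangulatedDisc.card_eq_three _ hT, Q.isTriangulatedDisc.card_eq_three _ hT']
  · refine ⟨c, fun x hx => ?_⟩
    simp only [Finset.mem_inter, Finset.mem_insert, Finset.mem_singleton] at hx ⊢
    rcases hx.1 with h | rfl | h
    · exact Or.inl h
    · exact absurd hx.2 hb
    · exact Or.inr h

lemma directions_inter (S S' : Set ℂ) : directions S ∩ directions S' = directions (S ∩ S') := by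
  ext φ; simp only [directions, Set.mem_inter_iff, Set.mem_ofPred_eq]; tauto

lemma directions_mono {S S' : Set ℂ} (h : S ⊆ S') : directions S ⊆ directions S' :=
  fun _ hφ => ⟨hφ.1, h hφ.2⟩

lemma isClosed_cone {T : Finset V} (hT : T ∈ Q.triangles) {v : V} (hv : v ∈ T) :
    IsClosed (Q.cone T v) := by
  obtain ⟨b, c, hab, hac, hbc, rfl⟩ := Q.isTriangulatedDisc.exists_others hT hv
  rw [cone_eq_sector]
  exact isClosed_sector (Q.cross_ne_zero hT hab hac hbc)

lemma measurableSet_directions {S : Set ℂ} (hS : MeasurableSet S) :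
    MeasurableSet (directions S) :=
  measurableSet_Icc.inter (continuous_unitDir.measurable hS)

lemma volume_directions_lt_top (S : Set ℂ) : volume (directions S) < ⊤ :=
  (measure_mono fun _ h => h.1).trans_lt (measure_Icc_lt_top (a := -Real.pi) (b := Real.pi))

/-- Angles add up because the cones of two distinct triangles at `v` meet inside a ray, which has
measure zero. -/
lemma volume_directions_iUnion_cone (v : V) :
    (volume (directions (⋃ T ∈ Q.triangles.filter fun T => v ∈ T, Q.cone T v))).toReal =
      ∑ T ∈ Q.triangles with v ∈ T, Q.angleAt T v := by
  have h1 : directions (⋃ T ∈ Q.triangles.filter fun T => v ∈ T, Q.cone T v) =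
      ⋃ T ∈ Q.triangles.filter fun T => v ∈ T, directions (Q.cone T v) := by
    ext φ; simp only [directions, Set.mem_iUnion, Set.mem_ofPred_eq, exists_prop]; tauto
  rw [h1, measure_biUnion_finset₀, ENNReal.toReal_sum fun T _ => (volume_directions_lt_top _).ne]
  · rfl
  · intro T hT T' hT' hne
    rw [Finset.mem_coe, Finset.mem_filter] at hT hT'
    obtain ⟨b, hb⟩ := Q.exists_inter_subset hT.1 hT'.1 hne hT.2 hT'.2
    change volume (directions _ ∩ directions _) = 0
    rw [directions_inter]
    refine measure_mono_null (directions_mono ?_) (volume_directions_ray (u := Q.pos b - Q.pos v))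
    exact fun z hz => Q.exists_ray hT.1 hT'.1 hT.2 hT'.2 hb hz.1 hz.2
  · intro T hT
    rw [Finset.mem_filter] at hT
    exact (measurableSet_directions (Q.isClosed_cone hT.1 hT.2).measurableSet).nullMeasurableSet

lemma exists_center {T : Finset V} (hT : T ∈ Q.triangles) :
    ∃ (c : ℂ) (r : ℝ), ∀ v ∈ T, dist (Q.pos v) c = r := by
  have : Nonempty T := by
    have : T.Nonempty := Finset.card_pos.1
      (by rw [Q.isTriangulatedDisc.card_eq_three T hT]; norm_num)
    exact this.to_subtype
  obtain ⟨cs, ⟨-, h⟩, -⟩ := (Q.nondegenerate T hT).existsUnique_dist_eq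
  exact ⟨cs.center, cs.radius, fun v hv => h ⟨⟨v, hv⟩, rfl⟩⟩

/-- The point at height `1` above `v` lies strictly above every hemisphere through `v`, so near it
only the condition of lying above the triangle matters, and directions are those of the cones at
`v`. -/
lemma dihedralInfinite_eq (v : V) :
    Q.dihedralInfinite v = ∑ T ∈ Q.triangles with v ∈ T, Q.angleAt T v := by
  rw [← volume_directions_iUnion_cone, dihedralInfinite, dihedralAngleAt]
  congr 2
  ext φ
  simp only [directions, Set.mem_ofPred_eq]
  refine and_congr_right fun _ => ?_
  have hpt : ∀ s : ℝ, ((Q.pos v, (1 : ℝ)) + s • (Real.cos φ • ((1 : ℂ), (0 : ℝ)) +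
      Real.sin φ • (Complex.I, (0 : ℝ))) : ℂ × ℝ) = (Q.pos v + s * unitDir φ, 1) := by
    intro s
    ext1
    · simp only [Prod.fst_add, Prod.smul_fst, Complex.real_smul]
      congr 2
      apply Complex.ext <;> simp [unitDir, Complex.cos_ofReal_re, Complex.sin_ofReal_re]
    · simp
  simp only [hpt, localSolid, Finset.singleton_subset_iff, Set.mem_iUnion, exists_prop]
  constructor
  · intro h
    obtain ⟨s, ⟨T, hT, h1⟩, hs0⟩ := (h.and self_mem_nhdsWithin).exists
    rw [Finset.mem_filter] at hT
    refine ⟨T, Finset.mem_filter.2 hT, ?_⟩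
    obtain ⟨b, c, hab, hac, hbc, rfl⟩ := Q.isTriangulatedDisc.exists_others hT.1 hT.2
    rw [cone_eq_sector]
    exact Q.mem_sector_of_mem hs0 h1.2.1
  · rintro ⟨T, hT, h⟩
    have hT' := Finset.mem_filter.1 hT
    obtain ⟨c, r, hcr⟩ := Q.exists_center hT'.1
    have hlim : ∀ᶠ s : ℝ in 𝓝[>] 0, r ^ 2 < dist (Q.pos v + s * unitDir φ) c ^ 2 + 1 ^ 2 := by
      have hc : Continuous fun s : ℝ => dist (Q.pos v + s * unitDir φ) c ^ 2 + 1 ^ 2 := by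
        fun_prop
      refine ((hc.tendsto 0).mono_left nhdsWithin_le_nhds).eventually_const_lt ?_
      simp [hcr v hT'.2]
    filter_upwards [h, hlim] with s h1 h2
    exact ⟨T, hT, one_pos, h1, c, r, hcr, h2.le⟩

/-- Two triangles with a common edge lie on opposite sides of it. -/
lemma cross_mul_cross_neg {a b c d : V} (hT : {a, b, c} ∈ Q.triangles)
    (hT' : {a, b, d} ∈ Q.triangles) (hab : a ≠ b) (hac : a ≠ c) (hbc : b ≠ c) (had : a ≠ d)
    (hbd : b ≠ d) (hcd : c ≠ d) :
    cross (Q.pos b - Q.pos a) (Q.pos c - Q.pos a) *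
      cross (Q.pos b - Q.pos a) (Q.pos d - Q.pos a) < 0 := by
  have h1 := Q.cross_ne_zero hT hab hac hbc
  have h2 := Q.cross_ne_zero hT' hab had hbd
  have e1 := Q.cone_eq_sector a b c
  have e2 := Q.cone_eq_sector a b d
  have hray := fun z => Q.exists_ray (z := z) hT hT' (v := a) (b := b) (by simp) (by simp) (fun x hx => by
    simp only [Finset.mem_inter, Finset.mem_insert, Finset.mem_singleton] at hx ⊢
    rcases hx with ⟨h | h | rfl, h' | h' | h'⟩ <;> tauto)
  rw [e1, e2] at hray
  set u := Q.pos b - Q.pos a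
  set w := Q.pos c - Q.pos a
  set w' := Q.pos d - Q.pos a
  -- If both triangles lay on the same side, `u + ε w` with small `ε > 0` would lie in both sectors
  -- without being on the ray of `u`, against `exists_ray`.
  by_contra! hpos
  replace hpos : 0 < cross u w * cross u w' := lt_of_le_of_ne hpos (mul_ne_zero h1 h2).symm
  obtain ⟨ε, hε, hlt⟩ : ∃ ε : ℝ, 0 < ε ∧ 0 < (cross u w' + ε * cross w w') * cross u w' := by
    have hc : Continuous fun ε : ℝ => (cross u w' + ε * cross w w') * cross u w' := by fun_prop
    have h0 : 0 < (cross u w' + 0 * cross w w') * cross u w' := by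
      rw [zero_mul, add_zero]; exact mul_self_pos.2 h2
    have := ((hc.tendsto 0).eventually_const_lt h0).filter_mono
      (nhdsWithin_le_nhds (s := Set.Ioi 0))
    obtain ⟨ε, h, h0⟩ := (this.and self_mem_nhdsWithin).exists
    exact ⟨ε, h0, h⟩
  have hz1 : ((1 : ℝ) : ℂ) * u + (ε : ℂ) * w ∈ sector u w := ⟨1, ε, zero_le_one, hε.le, rfl⟩
  have hz2 : ((1 : ℝ) : ℂ) * u + (ε : ℂ) * w ∈ sector u w' := by
    rw [mem_sector_iff h2, cross_lin_left, cross_lin_right, cross_self]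
    refine ⟨by linarith, ?_⟩
    have : 0 < ε * (cross u w * cross u w') := by positivity
    nlinarith
  obtain ⟨t, -, ht⟩ := hray _ hz1 hz2
  have : cross u (((1 : ℝ) : ℂ) * u + (ε : ℂ) * w) = cross u ((t : ℂ) * u + ((0 : ℝ) : ℂ) * u) := by
    rw [ht]; simp
  rw [cross_lin_right, cross_lin_right, cross_self] at this
  simp only [mul_zero, zero_add, mul_eq_zero] at this
  rcases this with h | h
  · exact hε.ne' h
  · exact h1 h

/-- The cones at an interior vertex cover the plane. -/
lemma mem_cone_of_interior {v : V} (hv : ¬ IsBoundaryVertex Q.triangles v) {z : ℂ} (hz : z ≠ 0) :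
    ∃ T ∈ Q.triangles, v ∈ T ∧ z ∈ Q.cone T v := by
  have D := Q.isTriangulatedDisc
  set U : Set ℂ := ⋃ T ∈ Q.triangles.filter (fun T => v ∈ T), Q.cone T v with hU
  have hclosed : IsClosed U := by
    refine isClosed_biUnion_finset fun T hT => ?_
    rw [Finset.mem_filter] at hT
    exact Q.isClosed_cone hT.1 hT.2
  -- An edge at an interior vertex has triangles on both sides, so the union of their cones is a
  -- neighbourhood of each point of the open ray along it.
  have hside : ∀ b c : V, v ≠ b → v ≠ c → b ≠ c → {v, b, c} ∈ Q.triangles → ∀ s : ℝ, 0 < s →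
      U ∈ 𝓝 ((s : ℂ) * (Q.pos b - Q.pos v)) := by
    intro b c hvb hvc hbc hT s hs
    obtain ⟨T', hT', hne⟩ : ∃ T' ∈ Q.triangles.filter (fun T => v ∈ T ∧ b ∈ T),
        T' ≠ {v, b, c} := by
      have h2 : numTriangles Q.triangles v b = 2 := (D.numTriangles_eq
        ⟨hvb, _, hT, by simp, by simp⟩).resolve_left fun h => hv ⟨b, hvb, h⟩
      exact Finset.exists_mem_ne (by unfold numTriangles at h2; omega) _
    rw [Finset.mem_filter] at hT'
    obtain ⟨d, hvd, hbd, rfl⟩ := D.exists_third hT'.1 hT'.2.1 hT'.2.2 hvb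
    have hcd : c ≠ d := fun h => hne (by rw [h])
    have h1 := Q.cross_ne_zero hT hvb hvc hbc
    have h2 := Q.cross_ne_zero hT'.1 hvb hvd hbd
    have hneg := Q.cross_mul_cross_neg hT hT'.1 hvb hvc hbc hvd hbd hcd
    have e1 := Q.cone_eq_sector v b c
    have e2 := Q.cone_eq_sector v b d
    set u := Q.pos b - Q.pos v
    set w := Q.pos c - Q.pos v
    set w' := Q.pos d - Q.pos v
    have hl : ∀ x : ℂ, cross ((s : ℂ) * u) x = s * cross u x := fun x => by
      simpa using cross_lin_left s 0 u 0 x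
    have hev : ∀ᶠ y in 𝓝 ((s : ℂ) * u), 0 < cross y w * cross u w ∧ 0 < cross y w' * cross u w' := by
      refine Eventually.and ?_ ?_
      · refine (Continuous.tendsto (by fun_prop) _).eventually_const_lt ?_
        rw [hl, mul_assoc]; exact mul_pos hs (mul_self_pos.2 h1)
      · refine (Continuous.tendsto (by fun_prop) _).eventually_const_lt ?_
        rw [hl, mul_assoc]; exact mul_pos hs (mul_self_pos.2 h2)
    filter_upwards [hev] with y hy
    rw [hU, Set.mem_iUnion₂]
    rcases le_or_gt 0 (cross u y * cross u w) with hge | hlt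
    · exact ⟨_, by simp [hT], e1 ▸ (mem_sector_iff h1).2 ⟨hy.1.le, hge⟩⟩
    · refine ⟨_, by simp [hT'.1], e2 ▸ (mem_sector_iff h2).2 ⟨hy.2.le, ?_⟩⟩
      have : 0 < (cross u y * cross u w') * (cross u w) ^ 2 := by
        nlinarith [mul_pos_of_neg_of_neg hlt hneg]
      exact (pos_of_mul_pos_left this (sq_nonneg _)).le
  have hopen : ∀ y ∈ U, y ≠ 0 → U ∈ 𝓝 y := by
    intro y hy hy0
    rw [hU, Set.mem_iUnion₂] at hy
    obtain ⟨T, hT, hyT⟩ := hy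
    have hTm := hT
    rw [Finset.mem_filter] at hT
    obtain ⟨b, c, hvb, hvc, hbc, rfl⟩ := D.exists_others hT.1 hT.2
    have h1 := Q.cross_ne_zero hT.1 hvb hvc hbc
    have e1 := Q.cone_eq_sector v b c
    rw [e1] at hyT
    obtain ⟨s, t, hs, ht, rfl⟩ := hyT
    rcases hs.eq_or_lt with rfl | hs
    · rcases ht.eq_or_lt with rfl | ht
      · simp at hy0
      · have := hside c b hvc hvb hbc.symm (by rw [Finset.pair_comm]; exact hT.1) t ht
        simpa using this
    · rcases ht.eq_or_lt with rfl | ht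
      · have := hside b c hvb hvc hbc hT.1 s hs
        simpa using this
      · set u := Q.pos b - Q.pos v
        set w := Q.pos c - Q.pos v
        have hsq : 0 < cross u w ^ 2 := by positivity
        have hev : ∀ᶠ y in 𝓝 ((s : ℂ) * u + t * w),
            0 < cross y w * cross u w ∧ 0 < cross u y * cross u w := by
          refine Eventually.and ?_ ?_
          · refine (Continuous.tendsto (by fun_prop) _).eventually_const_lt ?_
            rw [cross_lin_left, cross_self]
            nlinarith [mul_pos hs hsq]
          · refine (Continuous.tendsto (by fun_prop) _).eventually_const_lt ?_
            rw [cross_lin_right, cross_self]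
            nlinarith [mul_pos ht hsq]
        filter_upwards [hev] with y hy
        rw [hU, Set.mem_iUnion₂]
        exact ⟨_, hTm, e1 ▸ (mem_sector_iff h1).2 ⟨hy.1.le, hy.2.le⟩⟩
  -- The union of the cones is nonempty, open and closed in the punctured plane, which is connected.
  have hconn : IsPreconnected ({0}ᶜ : Set ℂ) :=
    (isConnected_compl_singleton_of_one_lt_rank (by simp [Complex.rank_real_complex]) 0).isPreconnected
  obtain ⟨w, -⟩ := (D.link_connected v).nonempty.elim fun w => (⟨w, trivial⟩ : ∃ _ : _, True)
  obtain ⟨-, T, hT, hvT, -⟩ := w.2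
  obtain ⟨b, c, hvb, hvc, hbc, rfl⟩ := D.exists_others hT hvT
  have h1 := Q.cross_ne_zero hT hvb hvc hbc
  have hb0 : Q.pos b - Q.pos v ≠ 0 := cross_ne_zero_left h1
  have hbU : Q.pos b - Q.pos v ∈ interior U := by
    rw [mem_interior_iff_mem_nhds]
    simpa using hside b c hvb hvc hbc hT 1 one_pos
  have := hconn.subset_of_closure_inter_subset isOpen_interior ⟨_, hb0, hbU⟩ (by
    rintro y ⟨hy, hy0⟩
    exact mem_interior_iff_mem_nhds.2
      (hopen y (closure_minimal interior_subset hclosed hy) hy0))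
  have hzU := interior_subset (this hz)
  rw [hU, Set.mem_iUnion₂] at hzU
  obtain ⟨T, hT, hzT⟩ := hzU
  rw [Finset.mem_filter] at hT
  exact ⟨T, hT.1, hT.2, hzT⟩

lemma sum_angleAt_of_interior {v : V} (hv : ¬ IsBoundaryVertex Q.triangles v) :
    ∑ T ∈ Q.triangles with v ∈ T, Q.angleAt T v = 2 * Real.pi := by
  rw [← volume_directions_iUnion_cone]
  have : directions (⋃ T ∈ Q.triangles.filter fun T => v ∈ T, Q.cone T v) =
      Set.Icc (-Real.pi) Real.pi := by
    ext φ
    refine ⟨fun h => h.1, fun h => ⟨h, ?_⟩⟩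
    obtain ⟨T, hT, hvT, hz⟩ := Q.mem_cone_of_interior hv
      (z := unitDir φ) (norm_pos_iff.1 (by rw [norm_unitDir]; exact one_pos))
    exact Set.mem_iUnion₂.2 ⟨T, Finset.mem_filter.2 ⟨hT, hvT⟩, hz⟩
  rw [this, Real.volume_Icc, ENNReal.toReal_ofReal (by linarith [Real.pi_pos])]
  ring

end TriangulatedPolygon

/-! ### Dihedral angles at the edges of the triangulation. -/

lemma sin_angle_mul_norm (x y : ℂ) :
    Real.sin (InnerProductGeometry.angle x y) * (‖x‖ * ‖y‖) = |cross x y| := by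
  rw [InnerProductGeometry.sin_angle_mul_norm_mul_norm, ← Real.sqrt_sq_eq_abs]
  congr 1
  simp only [Complex.inner, cross, Complex.mul_re, Complex.conj_re, Complex.conj_im]
  ring

lemma cos_angle_mul_norm (x y : ℂ) :
    Real.cos (InnerProductGeometry.angle x y) * (‖x‖ * ‖y‖) = x.re * y.re + x.im * y.im := by
  rw [InnerProductGeometry.cos_angle_mul_norm_mul_norm]
  simp only [Complex.inner, Complex.mul_re, Complex.conj_re, Complex.conj_im]
  ring

/-- The power of a point on a vertical plane orthogonal to the edge from `p` to `p + u`, at its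
midpoint, with respect to a sphere through `p`, `p + u`, `p + w` centred on `ℂ`. -/
lemma power_eq {p u w o : ℂ} {r d : ℝ} (hd : 0 < d) (hdu : d = ‖u‖) (hK : cross u w ≠ 0)
    (h1 : dist p o = r) (h2 : dist (p + u) o = r) (h3 : dist (p + w) o = r) (y t : ℝ) :
    dist (p + (u / 2 + y * (Complex.I * u / d))) o ^ 2 + (d / 2 + t) ^ 2 - r ^ 2 =
      y ^ 2 + t ^ 2 + d * t -
        y * (d * ((-w).re * (u - w).re + (-w).im * (u - w).im) / cross u w) := by
  have hsq : ∀ z : ℂ, ‖z‖ ^ 2 = z.re ^ 2 + z.im ^ 2 := fun z => by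
    rw [← Complex.normSq_eq_norm_sq, Complex.normSq_apply]; ring
  have e1 : r ^ 2 = (p - o).re ^ 2 + (p - o).im ^ 2 := by rw [← h1, dist_eq_norm, hsq]
  have e2 : r ^ 2 = (p + u - o).re ^ 2 + (p + u - o).im ^ 2 := by rw [← h2, dist_eq_norm, hsq]
  have e3 : r ^ 2 = (p + w - o).re ^ 2 + (p + w - o).im ^ 2 := by rw [← h3, dist_eq_norm, hsq]
  have e4 : d ^ 2 = u.re ^ 2 + u.im ^ 2 := by rw [hdu, hsq]
  have hre : (Complex.I * u / d).re = -u.im / d := by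
    rw [Complex.div_ofReal_re]; simp
  have him : (Complex.I * u / d).im = u.re / d := by
    rw [Complex.div_ofReal_im]; simp
  rw [dist_eq_norm, hsq]
  simp only [Complex.add_re, Complex.add_im, Complex.sub_re, Complex.sub_im, Complex.mul_re,
    Complex.mul_im, Complex.ofReal_re, Complex.ofReal_im, hre, him, Complex.neg_re,
    Complex.neg_im, Complex.div_ofNat_re, Complex.div_ofNat_im] at *
  -- Subtracting the equations for equal distances to `o` determines the component of `o - p`
  -- orthogonal to the edge.
  have hq : 2 * (u.re * (o.im - p.im) - u.im * (o.re - p.re)) * cross u w =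
      d ^ 2 * (-w.re * (u.re - w.re) + -w.im * (u.im - w.im)) := by
    unfold cross
    linear_combination (u.re ^ 2 + u.im ^ 2) * (e3 - e1) -
      (u.re * w.re + u.im * w.im) * (e2 - e1) -
      (-w.re * (u.re - w.re) + -w.im * (u.im - w.im)) * e4
  have hq' : d * (-w.re * (u.re - w.re) + -w.im * (u.im - w.im)) / cross u w =
      2 * (u.re * (o.im - p.im) - u.im * (o.re - p.re)) / d := by
    rw [div_eq_div_iff hK hd.ne']
    linear_combination -hq
  rw [hq']
  obtain ⟨a, ha⟩ : ∃ a, u.re = d * a := ⟨u.re / d, by field_simp⟩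
  obtain ⟨b, hb⟩ : ∃ b, u.im = d * b := ⟨u.im / d, by field_simp⟩
  have e5 : 2 * (u.re * (o.im - p.im) - u.im * (o.re - p.re)) / d =
      2 * (a * (o.im - p.im) - b * (o.re - p.re)) := by
    rw [ha, hb]; field_simp
  have e6 : -u.im / d = -b := by rw [hb]; field_simp
  have e7 : u.re / d = a := by rw [ha]; field_simp
  rw [e5, e6, e7]
  rw [ha, hb] at e2 e4 ⊢
  have hn : a ^ 2 + b ^ 2 = 1 := by
    have hd2 : d ^ 2 ≠ 0 := by positivity
    apply mul_left_cancel₀ hd2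
    linear_combination -e4
  linear_combination (-1 / 2 : ℝ) * e1 + (-1 / 2 : ℝ) * e2 + (y ^ 2 - d ^ 2 / 4) * hn

lemma cross_mul_I (u : ℂ) {d : ℝ} (hd : 0 < d) (hdu : d = ‖u‖) :
    cross u (Complex.I * u / d) = d := by
  have e4 : d ^ 2 = u.re ^ 2 + u.im ^ 2 := by
    rw [hdu, ← Complex.normSq_eq_norm_sq, Complex.normSq_apply]; ring
  rw [cross, Complex.div_ofReal_re, Complex.div_ofReal_im]
  simp
  field_simp
  linarith

namespace TriangulatedPolygon

variable {V : Type*} [DecidableEq V] (Q : TriangulatedPolygon V)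

/-- The points of the plane orthogonal to the edge `a b` at its top, in polar coordinates. -/
noncomputable def edgePoint (a b : V) (φ s : ℝ) : ℂ × ℝ :=
  ((Q.pos a + Q.pos b) / 2, dist (Q.pos a) (Q.pos b) / 2) + s • (Real.cos φ • ((0 : ℂ), (1 : ℝ)) +
    Real.sin φ • (Complex.I * (Q.pos b - Q.pos a) / (dist (Q.pos a) (Q.pos b) : ℂ), (0 : ℝ)))

lemma edgePoint_eq (a b : V) (φ s : ℝ) : Q.edgePoint a b φ s =
    (Q.pos a + ((Q.pos b - Q.pos a) / 2 + ((s * Real.sin φ : ℝ) : ℂ) *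
      (Complex.I * (Q.pos b - Q.pos a) / (dist (Q.pos a) (Q.pos b) : ℂ))),
      dist (Q.pos a) (Q.pos b) / 2 + s * Real.cos φ) := by
  rw [edgePoint]
  ext1
  · simp only [Prod.fst_add, Prod.smul_fst, Complex.real_smul]
    push_cast
    ring
  · simp

section Edge

variable {a b c : V} {d K G φ : ℝ}

/-- The two conditions say that the direction points to the side of `c` and not below the tangent
plane of the hemisphere. By `power_eq` the power along the direction is `s ^ 2` plus `s` times the
second quantity; `G` is the inner product of the sides at `c`. -/
lemma eventually_edgePoint_mem (hT : {a, b, c} ∈ Q.triangles) (hab : a ≠ b) (hac : a ≠ c)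
    (hbc : b ≠ c) (hd : d = dist (Q.pos a) (Q.pos b))
    (hK : K = cross (Q.pos b - Q.pos a) (Q.pos c - Q.pos a))
    (hG : G = (-(Q.pos c - Q.pos a)).re * ((Q.pos b - Q.pos a) - (Q.pos c - Q.pos a)).re +
      (-(Q.pos c - Q.pos a)).im * ((Q.pos b - Q.pos a) - (Q.pos c - Q.pos a)).im)
    (h1 : 0 ≤ Real.sin φ * K) (h2 : 0 ≤ d * Real.cos φ - Real.sin φ * (d * G / K)) :
    ∀ᶠ s : ℝ in 𝓝[>] 0, Q.edgePoint a b φ s ∈ Q.idealTetrahedron {a, b, c} := by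
  have hcr := Q.cross_ne_zero hT hab hac hbc
  have hu0 := cross_ne_zero_left hcr
  have hdu : d = ‖Q.pos b - Q.pos a‖ := by rw [hd, dist_comm, dist_eq_norm]
  have hd0 : 0 < d := hdu ▸ norm_pos_iff.2 hu0
  obtain ⟨o, r, hor⟩ := Q.exists_center hT
  have hpow := power_eq hd0 hdu hcr (hor a (by simp))
    (by rw [add_sub_cancel]; exact hor b (by simp))
    (by rw [add_sub_cancel]; exact hor c (by simp))
  have himg := Q.image_triple a b c
  have hcI := cross_mul_I _ hd0 hdu
  have hmain := cross_smul_add (Q.pos b - Q.pos a) (Q.pos c - Q.pos a)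
    (Complex.I * (Q.pos b - Q.pos a) / d)
  simp only [idealTetrahedron, edgePoint_eq, Set.mem_ofPred_eq, himg, ← hd]
  rw [← hG, ← hK] at hpow
  rw [← hK, hcI] at hmain
  rw [← hK] at hcr
  set u := Q.pos b - Q.pos a
  set w := Q.pos c - Q.pos a
  set n := Complex.I * u / d
  set k := cross n w / K with hk
  have hKc : (K : ℂ) ≠ 0 := by exact_mod_cast hcr
  have hlim : ∀ {x y z : ℝ}, x < y → ∀ᶠ s : ℝ in 𝓝[>] 0, x < y + s * z := by
    intro x y z hxy
    have hc : Continuous fun s : ℝ => y + s * z := by fun_prop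
    exact ((hc.tendsto 0).mono_left nhdsWithin_le_nhds).eventually_const_lt (by simpa using hxy)
  filter_upwards [hlim (x := 0) (y := d / 2) (z := Real.cos φ) (by positivity),
    hlim (x := 0) (y := 1 / 2) (z := Real.sin φ * k) (by norm_num),
    hlim (x := 0) (y := 1 / 2) (z := -(Real.sin φ * k + Real.sin φ * (d / K))) (by norm_num),
    self_mem_nhdsWithin] with s hs1 hs2 hs3 hs0
  have hs0 : 0 < s := hs0
  -- These are the coordinates of the midpoint of the edge, moved by `s sin φ` along the normal `n =
  -- k u + (d / K) w`.
  refine ⟨hs1, mem_convexHull_triple.2 ⟨1 / 2 + s * (Real.sin φ * k), s * (Real.sin φ * (d / K)),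
    hs2.le, ?_, by linarith, ?_⟩, o, r, hor, ?_⟩
  · have : Real.sin φ * (d / K) = Real.sin φ * K * (d / K ^ 2) := by field_simp
    rw [this]; positivity
  · have hn : n = (k : ℂ) * u + ((d / K : ℝ) : ℂ) * w := by
      rw [hk]; push_cast
      field_simp
      linear_combination hmain
    rw [hn]; push_cast; ring
  · have := hpow (s * Real.sin φ) (s * Real.cos φ)
    have e : (s * Real.sin φ) ^ 2 + (s * Real.cos φ) ^ 2 + d * (s * Real.cos φ) -
        s * Real.sin φ * (d * G / K) =
        s ^ 2 + s * (d * Real.cos φ - Real.sin φ * (d * G / K)) := by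
      linear_combination s ^ 2 * Real.sin_sq_add_cos_sq φ
    rw [e] at this
    have hnn : 0 ≤ s ^ 2 + s * (d * Real.cos φ - Real.sin φ * (d * G / K)) := by positivity
    linarith

lemma eventually_edgePoint_notMem (hT : {a, b, c} ∈ Q.triangles) (hab : a ≠ b) (hac : a ≠ c)
    (hbc : b ≠ c) (hd : d = dist (Q.pos a) (Q.pos b))
    (hK : K = cross (Q.pos b - Q.pos a) (Q.pos c - Q.pos a))
    (hG : G = (-(Q.pos c - Q.pos a)).re * ((Q.pos b - Q.pos a) - (Q.pos c - Q.pos a)).re +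
      (-(Q.pos c - Q.pos a)).im * ((Q.pos b - Q.pos a) - (Q.pos c - Q.pos a)).im)
    (h : ¬ (0 ≤ Real.sin φ * K ∧ 0 ≤ d * Real.cos φ - Real.sin φ * (d * G / K))) :
    ∀ᶠ s : ℝ in 𝓝[>] 0, Q.edgePoint a b φ s ∉ Q.idealTetrahedron {a, b, c} := by
  have hcr := Q.cross_ne_zero hT hab hac hbc
  have hu0 := cross_ne_zero_left hcr
  have hdu : d = ‖Q.pos b - Q.pos a‖ := by rw [hd, dist_comm, dist_eq_norm]
  have hd0 : 0 < d := hdu ▸ norm_pos_iff.2 hu0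
  have himg := Q.image_triple a b c
  have hcI := cross_mul_I _ hd0 hdu
  have hsmall : ∀ᶠ s : ℝ in 𝓝[>] 0, d * Real.cos φ - Real.sin φ * (d * G / K) < 0 →
      s + (d * Real.cos φ - Real.sin φ * (d * G / K)) < 0 := by
    generalize d * Real.cos φ - Real.sin φ * (d * G / K) = X
    by_cases hX : X < 0
    · filter_upwards [Ioo_mem_nhdsGT (show (0 : ℝ) < -X by linarith)] with s hs _
      linarith [hs.2]
    · exact Eventually.of_forall fun s h => absurd h hX
  filter_upwards [hsmall, self_mem_nhdsWithin] with s hs hs0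
  have hs0 : 0 < s := hs0
  simp only [idealTetrahedron, edgePoint_eq, Set.mem_ofPred_eq, himg, ← hd]
  rintro ⟨-, hhull, o, r, hor, hr⟩
  have hpow := power_eq hd0 hdu hcr (hor a (by simp))
    (by rw [add_sub_cancel]; exact hor b (by simp))
    (by rw [add_sub_cancel]; exact hor c (by simp)) (s * Real.sin φ) (s * Real.cos φ)
  rw [← hG, ← hK] at hpow
  refine h ⟨?_, ?_⟩
  · obtain ⟨α, β, -, hβ, -, he⟩ := mem_convexHull_triple.1 hhull
    have he := congrArg (cross (Q.pos b - Q.pos a)) (add_left_cancel he)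
    have hhalf : (Q.pos b - Q.pos a) / 2 = ((1 / 2 : ℝ) : ℂ) * (Q.pos b - Q.pos a) := by
      push_cast; ring
    rw [hhalf, cross_lin_right, cross_lin_right, cross_self, hcI, ← hK] at he
    have : s * d * (Real.sin φ * K) = β * K ^ 2 := by linear_combination K * he
    have h0 : 0 ≤ s * d * (Real.sin φ * K) := by rw [this]; positivity
    exact nonneg_of_mul_nonneg_right h0 (by positivity)
  · by_contra! hX
    have hneg := hs hX
    have e : (s * Real.sin φ) ^ 2 + (s * Real.cos φ) ^ 2 + d * (s * Real.cos φ) -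
        s * Real.sin φ * (d * G / K) =
        s * (s + (d * Real.cos φ - Real.sin φ * (d * G / K))) := by
      linear_combination s ^ 2 * Real.sin_sq_add_cos_sq φ
    rw [e] at hpow
    have := mul_neg_of_pos_of_neg hs0 hneg
    linarith

/-- The directions at the top of the edge `a b` that point into the tetrahedron over `T`. -/
def edgeDirections (T : Finset V) (a b : V) : Set ℝ :=
  {φ | φ ∈ Set.Icc (-Real.pi) Real.pi ∧
    ∀ᶠ s : ℝ in 𝓝[>] 0, Q.edgePoint a b φ s ∈ Q.idealTetrahedron T}

/-- Failing to point into the tetrahedron means leaving it for all small `s`, not merely for some;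
this lets the directions of a union be computed piece by piece. -/
lemma eventually_notMem_of_notMem (hT : {a, b, c} ∈ Q.triangles) (hab : a ≠ b) (hac : a ≠ c)
    (hbc : b ≠ c) (hφ : φ ∈ Set.Icc (-Real.pi) Real.pi)
    (h : φ ∉ Q.edgeDirections {a, b, c} a b) :
    ∀ᶠ s : ℝ in 𝓝[>] 0, Q.edgePoint a b φ s ∉ Q.idealTetrahedron {a, b, c} :=
  Q.eventually_edgePoint_notMem hT hab hac hbc rfl rfl rfl fun hc =>
    h ⟨hφ, Q.eventually_edgePoint_mem hT hab hac hbc rfl rfl rfl hc.1 hc.2⟩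

lemma mem_edgeDirections_iff (hT : {a, b, c} ∈ Q.triangles) (hab : a ≠ b) (hac : a ≠ c)
    (hbc : b ≠ c) (hd : d = dist (Q.pos a) (Q.pos b))
    (hK : K = cross (Q.pos b - Q.pos a) (Q.pos c - Q.pos a))
    (hG : G = (-(Q.pos c - Q.pos a)).re * ((Q.pos b - Q.pos a) - (Q.pos c - Q.pos a)).re +
      (-(Q.pos c - Q.pos a)).im * ((Q.pos b - Q.pos a) - (Q.pos c - Q.pos a)).im)
    (hφ : φ ∈ Set.Icc (-Real.pi) Real.pi) :
    φ ∈ Q.edgeDirections {a, b, c} a b ↔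
      0 ≤ Real.sin φ * K ∧ 0 ≤ d * Real.cos φ - Real.sin φ * (d * G / K) := by
  refine ⟨fun h => ?_,
    fun hc => ⟨hφ, Q.eventually_edgePoint_mem hT hab hac hbc hd hK hG hc.1 hc.2⟩⟩
  by_contra hc
  obtain ⟨s, h1, h2⟩ :=
    (h.2.and (Q.eventually_edgePoint_notMem hT hab hac hbc hd hK hG hc)).exists
  exact h2 h1

lemma angleAt_lt_pi (hT : {a, b, c} ∈ Q.triangles) (hab : a ≠ b) (hac : a ≠ c) (hbc : b ≠ c) :
    Q.angleAt {a, b, c} c < Real.pi := by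
  have h := Q.angleAt_add hT hab hac hbc
  have h1 := Q.angleAt_pos hT (a := a) (by simp)
  have h2 := Q.angleAt_pos hT (a := b) (by simp)
  linarith

/-- The directions that point into a tetrahedron form an interval, whose length is the angle of
the triangle opposite to the edge. -/
lemma edgeDirections_eq (hT : {a, b, c} ∈ Q.triangles) (hab : a ≠ b) (hac : a ≠ c) (hbc : b ≠ c) :
    (0 < cross (Q.pos b - Q.pos a) (Q.pos c - Q.pos a) →
      Q.edgeDirections {a, b, c} a b = Set.Icc 0 (Q.angleAt {a, b, c} c)) ∧
    (cross (Q.pos b - Q.pos a) (Q.pos c - Q.pos a) < 0 →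
      Q.edgeDirections {a, b, c} a b = Set.Icc (-Q.angleAt {a, b, c} c) 0) := by
  have hT3 : ({c, a, b} : Finset V) ∈ Q.triangles := by
    rwa [rotate_triple c a b]
  have hγ0 := Q.angleAt_pos hT (a := c) (by simp)
  have hγπ := Q.angleAt_lt_pi hT hab hac hbc
  have hγ : Q.angleAt {a, b, c} c =
      InnerProductGeometry.angle (Q.pos a - Q.pos c) (Q.pos b - Q.pos c) := by
    rw [← rotate_triple c a b, Q.angleAt_eq hT3 hac.symm hbc.symm hab]
  have hsin := sin_angle_mul_norm (Q.pos a - Q.pos c) (Q.pos b - Q.pos c)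
  have hcos := cos_angle_mul_norm (Q.pos a - Q.pos c) (Q.pos b - Q.pos c)
  have hcr3 := Q.cross_ne_zero hT3 hac.symm hbc.symm hab
  have hN : 0 < ‖Q.pos a - Q.pos c‖ * ‖Q.pos b - Q.pos c‖ :=
    mul_pos (norm_pos_iff.2 (cross_ne_zero_left hcr3)) (norm_pos_iff.2 (cross_ne_zero_right hcr3))
  have hKK : cross (Q.pos a - Q.pos c) (Q.pos b - Q.pos c) =
      cross (Q.pos b - Q.pos a) (Q.pos c - Q.pos a) := by
    simp [cross]; ring
  have hcr := Q.cross_ne_zero hT hab hac hbc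
  have hd0 : 0 < dist (Q.pos a) (Q.pos b) :=
    dist_pos.2 fun h => cross_ne_zero_left hcr (sub_eq_zero.2 h.symm)
  have hmem := fun φ => Q.mem_edgeDirections_iff (φ := φ) hT hab hac hbc rfl rfl rfl
  rw [← hγ, hKK] at hsin
  rw [← hγ] at hcos
  set K := cross (Q.pos b - Q.pos a) (Q.pos c - Q.pos a)
  set N := ‖Q.pos a - Q.pos c‖ * ‖Q.pos b - Q.pos c‖
  set γ := Q.angleAt {a, b, c} c
  set d := dist (Q.pos a) (Q.pos b)
  have hG : (-(Q.pos c - Q.pos a)).re * ((Q.pos b - Q.pos a) - (Q.pos c - Q.pos a)).re +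
      (-(Q.pos c - Q.pos a)).im * ((Q.pos b - Q.pos a) - (Q.pos c - Q.pos a)).im =
      Real.cos γ * N := by
    rw [hcos]; simp
  rw [hG] at hmem
  have hpi := Real.pi_pos
  constructor
  · intro hK
    rw [abs_of_pos hK] at hsin
    -- With `K = N sin γ` and `G = N cos γ`, the tangent condition becomes the addition formula for
    -- `sin (γ - φ)`.
    have key : ∀ φ, (0 ≤ Real.sin φ * K ∧
        0 ≤ d * Real.cos φ - Real.sin φ * (d * (Real.cos γ * N) / K)) ↔
        0 ≤ Real.sin φ ∧ 0 ≤ Real.sin (γ - φ) := by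
      intro φ
      have : d * Real.cos φ - Real.sin φ * (d * (Real.cos γ * N) / K) =
          Real.sin (γ - φ) * (d * N / K) := by
        rw [Real.sin_sub]; field_simp; rw [← hsin]; ring
      rw [this, mul_nonneg_iff_of_pos_right hK, mul_nonneg_iff_of_pos_right (by positivity)]
    ext φ
    constructor
    · intro h
      exact (sin_nonneg_and_iff hγ0 hγπ h.1.1 h.1.2).1 ((key φ).1 ((hmem φ h.1).1 h))
    · intro h
      have hφ : φ ∈ Set.Icc (-Real.pi) Real.pi := ⟨by linarith [h.1], by linarith [h.2]⟩
      exact (hmem φ hφ).2 ((key φ).2 ((sin_nonneg_and_iff hγ0 hγπ hφ.1 hφ.2).2 h))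
  · intro hK
    rw [abs_of_neg hK] at hsin
    have hK' : 0 < -K := by linarith
    -- The opposite orientation is the mirror image under `φ ↦ -φ`.
    have key : ∀ φ, (0 ≤ Real.sin φ * K ∧
        0 ≤ d * Real.cos φ - Real.sin φ * (d * (Real.cos γ * N) / K)) ↔
        0 ≤ Real.sin (-φ) ∧ 0 ≤ Real.sin (γ - -φ) := by
      intro φ
      have h1 : d * Real.cos φ - Real.sin φ * (d * (Real.cos γ * N) / K) =
          Real.sin (γ - -φ) * (d * N / -K) := by
        rw [sub_neg_eq_add, Real.sin_add]
        field_simp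
        have : K = -(Real.sin γ * N) := by linarith
        rw [this]; ring
      have h2 : Real.sin φ * K = Real.sin (-φ) * -K := by rw [Real.sin_neg]; ring
      rw [h1, h2, mul_nonneg_iff_of_pos_right hK', mul_nonneg_iff_of_pos_right (by positivity)]
    ext φ
    constructor
    · intro h
      have := (sin_nonneg_and_iff hγ0 hγπ (by linarith [h.1.2]) (by linarith [h.1.1])).1
        ((key φ).1 ((hmem φ h.1).1 h))
      exact ⟨by linarith [this.2], by linarith [this.1]⟩
    · intro h
      have hφ : φ ∈ Set.Icc (-Real.pi) Real.pi := ⟨by linarith [h.1], by linarith [h.2]⟩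
      exact (hmem φ hφ).2 ((key φ).2 ((sin_nonneg_and_iff hγ0 hγπ (by linarith [hφ.2])
        (by linarith [hφ.1])).2 ⟨by linarith [h.2], by linarith [h.1]⟩))

lemma volume_edgeDirections (hT : {a, b, c} ∈ Q.triangles) (hab : a ≠ b) (hac : a ≠ c)
    (hbc : b ≠ c) : MeasurableSet (Q.edgeDirections {a, b, c} a b) ∧
      volume (Q.edgeDirections {a, b, c} a b) = ENNReal.ofReal (Q.angleAt {a, b, c} c) := by
  rcases lt_or_gt_of_ne (Q.cross_ne_zero hT hab hac hbc) with h | h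
  · rw [(Q.edgeDirections_eq hT hab hac hbc).2 h, Real.volume_Icc]
    exact ⟨measurableSet_Icc, by congr 1; ring⟩
  · rw [(Q.edgeDirections_eq hT hab hac hbc).1 h, Real.volume_Icc]
    exact ⟨measurableSet_Icc, by congr 1; ring⟩

end Edge

/-- The triangles lie on opposite sides of the edge, so one interval begins and the other ends at
the vertical direction `φ = 0`. -/
lemma edgeDirections_inter_null {a b : V} (hab : a ≠ b) {T T' : Finset V} (hT : T ∈ Q.triangles)
    (hT' : T' ∈ Q.triangles) (ha : a ∈ T) (hb : b ∈ T) (ha' : a ∈ T') (hb' : b ∈ T')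
    (hne : T ≠ T') :
    volume (Q.edgeDirections T a b ∩ Q.edgeDirections T' a b) = 0 := by
  have D := Q.isTriangulatedDisc
  obtain ⟨c, hac, hbc, rfl⟩ := D.exists_third hT ha hb hab
  obtain ⟨d, had, hbd, rfl⟩ := D.exists_third hT' ha' hb' hab
  have hcd : c ≠ d := fun h => hne (by rw [h])
  have hneg := Q.cross_mul_cross_neg hT hT' hab hac hbc had hbd hcd
  refine measure_mono_null (t := {0}) ?_ (by simp)
  intro φ hφ
  rcases mul_neg_iff.1 hneg with ⟨h1, h2⟩ | ⟨h1, h2⟩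
  · rw [(Q.edgeDirections_eq hT hab hac hbc).1 h1, (Q.edgeDirections_eq hT' hab had hbd).2 h2] at hφ
    exact le_antisymm hφ.2.2 hφ.1.1
  · rw [(Q.edgeDirections_eq hT hab hac hbc).2 h1, (Q.edgeDirections_eq hT' hab had hbd).1 h2] at hφ
    exact le_antisymm hφ.1.2 hφ.2.1

/-- The dihedral angle at an edge of the triangulation is the sum of the opposite angles. -/
lemma dihedralFinite_eq {a b : V} (hab : a ≠ b) :
    Q.dihedralFinite a b = ∑ T ∈ Q.triangles with a ∈ T ∧ b ∈ T,
      (Real.pi - Q.angleAt T a - Q.angleAt T b) := by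
  have D := Q.isTriangulatedDisc
  have hset : {φ : ℝ | φ ∈ Set.Icc (-Real.pi) Real.pi ∧
      ∀ᶠ s : ℝ in 𝓝[>] 0, Q.edgePoint a b φ s ∈ Q.localSolid {a, b}} =
      ⋃ T ∈ Q.triangles.filter fun T => a ∈ T ∧ b ∈ T, Q.edgeDirections T a b := by
    ext φ
    simp only [localSolid, Finset.insert_subset_iff, Finset.singleton_subset_iff,
      Set.mem_iUnion, exists_prop, Set.mem_ofPred_eq]
    constructor
    · rintro ⟨hφ, h⟩
      by_contra! hno
      have hall : ∀ᶠ s : ℝ in 𝓝[>] 0, ∀ T ∈ Q.triangles.filter (fun T => a ∈ T ∧ b ∈ T),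
          Q.edgePoint a b φ s ∉ Q.idealTetrahedron T := by
        rw [Filter.eventually_all_finset]
        intro T hT
        have hφT := hno T hT
        rw [Finset.mem_filter] at hT
        obtain ⟨c, hac, hbc, rfl⟩ := D.exists_third hT.1 hT.2.1 hT.2.2 hab
        exact Q.eventually_notMem_of_notMem hT.1 hab hac hbc hφ hφT
      obtain ⟨s, ⟨T, hT, h1⟩, h2⟩ := (h.and hall).exists
      exact h2 T hT h1
    · rintro ⟨T, hT, hφ, h⟩
      exact ⟨hφ, h.mono fun s hs => ⟨T, hT, hs⟩⟩
  change (volume {φ : ℝ | φ ∈ Set.Icc (-Real.pi) Real.pi ∧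
      ∀ᶠ s : ℝ in 𝓝[>] 0, Q.edgePoint a b φ s ∈ Q.localSolid {a, b}}).toReal = _
  have hvol : ∀ T ∈ Q.triangles.filter fun T => a ∈ T ∧ b ∈ T,
      MeasurableSet (Q.edgeDirections T a b) ∧ volume (Q.edgeDirections T a b) =
        ENNReal.ofReal (Real.pi - Q.angleAt T a - Q.angleAt T b) ∧
        0 ≤ Real.pi - Q.angleAt T a - Q.angleAt T b := by
    intro T hT
    rw [Finset.mem_filter] at hT
    obtain ⟨c, hac, hbc, rfl⟩ := D.exists_third hT.1 hT.2.1 hT.2.2 hab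
    have h := Q.volume_edgeDirections hT.1 hab hac hbc
    have h2 := Q.angleAt_add hT.1 hab hac hbc
    have h3 := Q.angleAt_pos hT.1 (a := c) (by simp)
    refine ⟨h.1, ?_, by linarith⟩
    rw [h.2]; congr 1; linarith
  rw [hset, measure_biUnion_finset₀,
    ENNReal.toReal_sum fun T hT => by rw [(hvol T hT).2.1]; exact ENNReal.ofReal_ne_top]
  · refine Finset.sum_congr rfl fun T hT => ?_
    rw [(hvol T hT).2.1, ENNReal.toReal_ofReal (hvol T hT).2.2]
  · intro T hT T' hT' hne
    rw [Finset.mem_coe, Finset.mem_filter] at hT hT'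
    exact Q.edgeDirections_inter_null hab hT.1 hT'.1 hT.2.1 hT.2.2 hT'.2.1 hT'.2.2 hne
  · exact fun T hT => (hvol T hT).1.nullMeasurableSet

end TriangulatedPolygon

/-! ### Defects of triangles and the angle sum of a cut. -/

namespace TriangulatedPolygon

variable {V : Type*} [DecidableEq V] (Q : TriangulatedPolygon V) {A : Finset V}

/-- The contribution of a triangle to the difference between the angle sum of the cut of `A` and
its bound. -/
noncomputable def defect (A T : Finset V) : ℝ :=
  ∑ x ∈ (A ∩ T) ×ˢ (T \ A), (Real.pi - Q.angleAt T x.1 - Q.angleAt T x.2) +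
    ∑ a ∈ A ∩ T, Q.angleAt T a - Real.pi * (A ∩ T).card + if T ⊆ A then 2 * Real.pi else 0

lemma sum_product_eq {T : Finset V} (hT : T ∈ Q.triangles) :
    ∑ x ∈ (A ∩ T) ×ˢ (T \ A), (Real.pi - Q.angleAt T x.1 - Q.angleAt T x.2) =
      (A ∩ T).card * (T \ A).card * Real.pi - (T \ A).card * ∑ a ∈ A ∩ T, Q.angleAt T a -
        (A ∩ T).card * (Real.pi - ∑ a ∈ A ∩ T, Q.angleAt T a) := by
  have h : ∑ a ∈ T \ A, Q.angleAt T a = Real.pi - ∑ a ∈ A ∩ T, Q.angleAt T a := by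
    rw [← Q.sum_angleAt hT, Finset.inter_comm A T,
      ← Finset.sum_inter_add_sum_sdiff T A fun a => Q.angleAt T a]
    ring
  rw [Finset.sum_product]
  simp only [Finset.sum_sub_distrib, Finset.sum_const, nsmul_eq_mul, h, ← Finset.mul_sum]
  ring

lemma defect_eq_zero {T : Finset V} (hT : T ∈ Q.triangles) (h : (A ∩ T).card ≠ 2) :
    Q.defect A T = 0 := by
  have h3 := Q.isTriangulatedDisc.card_eq_three T hT
  have hadd : (A ∩ T).card + (T \ A).card = 3 := by
    rw [Finset.inter_comm, Finset.card_inter_add_card_sdiff, h3]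
  have hsub : T ⊆ A ↔ (T \ A).card = 0 := by
    rw [Finset.card_eq_zero, Finset.sdiff_eq_empty_iff_subset]
  rw [defect, Q.sum_product_eq hT]
  obtain h0 | h1 | h3' : (A ∩ T).card = 0 ∨ (A ∩ T).card = 1 ∨ (A ∩ T).card = 3 := by omega
  · have hβ : (T \ A).card = 3 := by omega
    rw [if_neg (by rw [hsub]; omega), h0, hβ, Finset.card_eq_zero.1 h0]
    simp
  · have hβ : (T \ A).card = 2 := by omega
    rw [if_neg (by rw [hsub]; omega), h1, hβ]
    push_cast; ring
  · have hβ : (T \ A).card = 0 := by omega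
    have hTA := hsub.2 hβ
    rw [if_pos hTA, h3', hβ, Finset.inter_eq_right.2 hTA, Q.sum_angleAt hT]
    push_cast; ring

/-- Here the defect is minus twice the angle at the single vertex of `T` outside `A`. -/
lemma defect_neg {T : Finset V} (hT : T ∈ Q.triangles) (h : (A ∩ T).card = 2) :
    Q.defect A T < 0 := by
  have h3 := Q.isTriangulatedDisc.card_eq_three T hT
  have hβ : (T \ A).card = 1 := by
    have : (A ∩ T).card + (T \ A).card = 3 := by
      rw [Finset.inter_comm, Finset.card_inter_add_card_sdiff, h3]
    omega
  obtain ⟨b, hb⟩ := Finset.card_eq_one.1 hβ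
  have hbT : b ∈ T := by
    have : b ∈ T \ A := hb ▸ Finset.mem_singleton_self b
    exact (Finset.mem_sdiff.1 this).1
  have hpos := Q.angleAt_pos hT hbT
  have hsum := Finset.sum_inter_add_sum_sdiff T A fun a => Q.angleAt T a
  rw [hb, Finset.sum_singleton, Q.sum_angleAt hT, Finset.inter_comm] at hsum
  have hsub : ¬ T ⊆ A := by
    rw [← Finset.sdiff_eq_empty_iff_subset, hb]; exact Finset.singleton_ne_empty b
  rw [defect, Q.sum_product_eq hT, if_neg hsub, h, hβ]
  push_cast
  linarith

lemma defect_nonpos {T : Finset V} (hT : T ∈ Q.triangles) : Q.defect A T ≤ 0 := by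
  by_cases h : (A ∩ T).card = 2
  · exact (Q.defect_neg hT h).le
  · exact (Q.defect_eq_zero hT h).le

variable [Fintype V]

lemma sum_cross_dihedral :
    ∑ x ∈ crossPairs Q.triangles A, Q.dihedralFinite x.1 x.2 =
      ∑ T ∈ Q.triangles, ∑ x ∈ (A ∩ T) ×ˢ (T \ A),
        (Real.pi - Q.angleAt T x.1 - Q.angleAt T x.2) := by
  rw [Finset.sum_congr rfl fun x hx => Q.dihedralFinite_eq (mem_crossPairs.1 hx).1.1]
  refine Finset.sum_comm' ?_
  rintro ⟨a, b⟩ T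
  rw [mem_crossPairs]
  simp only [Finset.mem_filter, Finset.mem_product, Finset.mem_inter, Finset.mem_sdiff]
  constructor
  · tauto
  · rintro ⟨⟨⟨h1, h2⟩, h3, h4⟩, hT⟩
    exact ⟨⟨⟨fun h => h4 (h ▸ h1), T, hT, h2, h3⟩, h1, h4⟩, hT, h2, h3⟩

-- Summing the triangle angles over all of `A` also counts the interior vertices, each of which
-- contributes `2π` and has no edge to `∞`; the correction removes them.
omit [Fintype V] in
lemma sum_boundary_dihedral :
    ∑ a ∈ boundaryIn Q.triangles A, Q.dihedralInfinite a =
      ∑ T ∈ Q.triangles, ∑ a ∈ A ∩ T, Q.angleAt T a -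
        2 * Real.pi * (A.card - (boundaryIn Q.triangles A).card) := by
  classical
  have h1 : ∑ a ∈ A, Q.dihedralInfinite a =
      ∑ T ∈ Q.triangles, ∑ a ∈ A ∩ T, Q.angleAt T a := by
    simp only [dihedralInfinite_eq]
    refine Finset.sum_comm' fun a T => ?_
    simp only [Finset.mem_filter, Finset.mem_inter]
    tauto
  have hsub : boundaryIn Q.triangles A ⊆ A := Finset.filter_subset _ _
  rw [← h1, ← Finset.sum_sdiff hsub,
    Finset.sum_congr rfl (s₁ := A \ boundaryIn Q.triangles A) (g := fun _ => 2 * Real.pi)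
      fun a ha => ?_]
  · rw [Finset.sum_const, nsmul_eq_mul, Finset.card_sdiff_of_subset hsub,
      Nat.cast_sub (Finset.card_le_card hsub)]
    ring
  · rw [dihedralInfinite_eq, Q.sum_angleAt_of_interior]
    intro hb
    rw [Finset.mem_sdiff] at ha
    exact ha.2 (Finset.mem_filter.2 ⟨ha.1, hb⟩)

section Cut

variable {C : Finset (Sym2 (Option V))}

/-- The membership condition for the cut of `A`, split into edges of the triangulation and edges
to `∞`. -/
lemma cut_eq (hC : ∀ x y, s(x, y) ∈ C ↔ Q.polyhedronSkeleton.Adj x y ∧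
      ¬ (x ∈ some '' (A : Set V) ↔ y ∈ some '' (A : Set V))) :
    C = ((crossPairs Q.triangles A).image fun x => s(some x.1, some x.2)) ∪
      (boundaryIn Q.triangles A).image fun a => s(some a, none) := by
  classical
  have hadj : ∀ a b, Q.polyhedronSkeleton.Adj (some a) (some b) ↔ (skeleton Q.triangles).Adj a b :=
    fun _ _ => Iff.rfl
  have hadj' : ∀ a, Q.polyhedronSkeleton.Adj (some a) none ↔ IsBoundaryVertex Q.triangles a :=
    fun _ => Iff.rfl
  have hsome : ∀ a, s(some a, none) ∈ C ↔ a ∈ boundaryIn Q.triangles A := by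
    intro a
    rw [hC, hadj', boundaryIn, Finset.mem_filter]
    simp; tauto
  ext e
  induction e using Sym2.ind with | _ x y
  simp only [Finset.mem_union, Finset.mem_image, Prod.exists, mem_crossPairs]
  constructor
  · intro h
    rcases x with _ | a <;> rcases y with _ | b
    · exact absurd ((hC _ _).1 h).1 (Q.polyhedronSkeleton.irrefl)
    · rw [Sym2.eq_swap] at h
      exact Or.inr ⟨b, (hsome b).1 h, Sym2.eq_swap⟩
    · exact Or.inr ⟨a, (hsome a).1 h, rfl⟩
    · left
      rw [hC, hadj] at h
      simp only [Set.mem_image, Finset.mem_coe, Option.some.injEq, exists_eq_right] at h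
      by_cases ha : a ∈ A
      · exact ⟨a, b, ⟨h.1, ha, fun hb => h.2 ⟨fun _ => hb, fun _ => ha⟩⟩, rfl⟩
      · have hb : b ∈ A := by
          by_contra hb; exact h.2 ⟨fun h => absurd h ha, fun h => absurd h hb⟩
        exact ⟨b, a, ⟨h.1.symm, hb, ha⟩, Sym2.eq_swap⟩
  · rintro (⟨a, b, ⟨h1, h2, h3⟩, he⟩ | ⟨a, ha, he⟩)
    · rw [← he, hC, hadj]
      refine ⟨h1, ?_⟩
      simp [h2, h3]
    · rw [← he]; exact (hsome a).2 ha

lemma sum_cut (hC : ∀ x y, s(x, y) ∈ C ↔ Q.polyhedronSkeleton.Adj x y ∧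
      ¬ (x ∈ some '' (A : Set V) ↔ y ∈ some '' (A : Set V))) {M : Type*} [AddCommMonoid M]
    (f : Sym2 (Option V) → M) :
    ∑ e ∈ C, f e = ∑ x ∈ crossPairs Q.triangles A, f s(some x.1, some x.2) +
      ∑ a ∈ boundaryIn Q.triangles A, f s(some a, none) := by
  rw [Q.cut_eq hC, Finset.sum_union, Finset.sum_image, Finset.sum_image]
  · intro a _ b _ hab
    simpa using hab
  · rintro ⟨a, b⟩ h ⟨a', b'⟩ h' hab
    have h := mem_crossPairs.1 h
    have h' := mem_crossPairs.1 h'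
    simp only [Sym2.eq_iff, Option.some.injEq] at hab
    rcases hab with ⟨rfl, rfl⟩ | ⟨rfl, rfl⟩
    · rfl
    · exact absurd h.2.1 h'.2.2
  · refine Finset.disjoint_left.2 fun e he he' => ?_
    obtain ⟨x, -, rfl⟩ := Finset.mem_image.1 he
    obtain ⟨a, -, h⟩ := Finset.mem_image.1 he'
    simp at h

/-- Both kinds of dihedral angles are rewritten as sums over triangles. The remaining multiples of
`π` count vertices, triangles and cut edges, and they match by `card_cut`. -/
lemma sum_dihedralAngle (hne : A.Nonempty) (hA : IsLinked (skeleton Q.triangles) (A : Set V))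
    (hA' : IsLinked Q.polyhedronSkeleton (some '' (A : Set V))ᶜ)
    (hC : ∀ x y, s(x, y) ∈ C ↔ Q.polyhedronSkeleton.Adj x y ∧
      ¬ (x ∈ some '' (A : Set V) ↔ y ∈ some '' (A : Set V))) :
    ∑ e ∈ C, Q.dihedralAngle e =
      ((C.card : ℝ) - 2) * Real.pi + ∑ T ∈ Q.triangles, Q.defect A T := by
  have hcard : C.card = (crossPairs Q.triangles A).card + (boundaryIn Q.triangles A).card := by
    simpa only [Finset.card_eq_sum_ones] using Q.sum_cut hC fun _ => 1
  have hcut := Q.card_cut hne hA hA'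
  have hN : ∑ T ∈ Q.triangles, (if T ⊆ A then 2 * Real.pi else 0) =
      (trianglesIn Q.triangles A).card * (2 * Real.pi) := by
    rw [← Finset.sum_filter, Finset.sum_const, nsmul_eq_mul]; rfl
  have h1 := Q.sum_cross_dihedral (A := A)
  have h2 := Q.sum_boundary_dihedral (A := A)
  have hcut' : ((crossPairs Q.triangles A).card : ℝ) + 2 * A.card +
      2 * (trianglesIn Q.triangles A).card =
      ∑ T ∈ Q.triangles, ((A ∩ T).card : ℝ) + (boundaryIn Q.triangles A).card + 2 := by
    exact_mod_cast hcut
  rw [Q.sum_cut hC, hcard]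
  change ∑ x ∈ crossPairs Q.triangles A, Q.dihedralFinite x.1 x.2 +
    ∑ a ∈ boundaryIn Q.triangles A, Q.dihedralInfinite a = _
  simp only [defect, Finset.sum_add_distrib, Finset.sum_sub_distrib, hN, ← Finset.mul_sum, h1, h2]
  simp only [Finset.sum_sub_distrib] at *
  push_cast
  linear_combination (-Real.pi) * hcut'

omit [Fintype V] in
/-- If no triangle has exactly two vertices in `A`, then the edges of the cut have a common
endpoint. -/
lemma exists_common_vertex (hne : A.Nonempty)
    (hA : IsLinked (skeleton Q.triangles) (A : Set V))
    (hC : ∀ x y, s(x, y) ∈ C ↔ Q.polyhedronSkeleton.Adj x y ∧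
      ¬ (x ∈ some '' (A : Set V) ↔ y ∈ some '' (A : Set V)))
    (h2 : ∀ T ∈ Q.triangles, (A ∩ T).card ≠ 2) : ∃ v : Option V, ∀ e ∈ C, v ∈ e := by
  have D := Q.isTriangulatedDisc
  obtain ⟨a, ha⟩ := hne
  -- If `A` contains an edge, then a triangle with two vertices in `A` has its third there too,
  -- which spreads around links and then over the disc, so the common vertex is `∞`. Otherwise `A`
  -- is the single vertex `a`.
  by_cases hsingle : ∃ a' ∈ A, (skeleton Q.triangles).Adj a a'
  · have hthird : ∀ x y z, x ≠ y → {x, y, z} ∈ Q.triangles → x ∈ A → y ∈ A → z ∈ A := by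
      intro x y z hxy hT hx hy
      by_contra hz
      apply h2 _ hT
      rw [Finset.inter_insert_of_mem hx, Finset.inter_insert_of_mem hy,
        Finset.inter_singleton_of_notMem hz, insert_empty_eq, Finset.card_pair hxy]
    have hstar : ∀ x y, x ∈ A → y ∈ A → (skeleton Q.triangles).Adj x y →
        ∀ z, (skeleton Q.triangles).Adj x z → z ∈ A := fun x y hx hy hxy z hxz =>
      D.link_induction x (· ∈ A) (fun p q hp _ _ hT hpA => hthird x p q hp hT hx hpA) hxy hy hxz
    have hall : ∀ x, x ∈ A := by
      intro x
      obtain ⟨a', ha', haa'⟩ := hsingle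
      exact (isLinked_univ_of_connected D.connected
        (fun x => x ∈ A ∧ ∃ y ∈ A, (skeleton Q.triangles).Adj x y) a trivial
        ⟨ha, a', ha', haa'⟩ (fun u _ w _ huw ⟨hu, y, hy, huy⟩ =>
          ⟨hstar u y hu hy huy w huw, u, hu, huw.symm⟩) x trivial).1
    refine ⟨none, fun e he => ?_⟩
    induction e using Sym2.ind with | _ x y
    have := ((hC x y).1 he).2
    rcases x with _ | x <;> rcases y with _ | y <;> simp_all
  · have hAa : ∀ x ∈ A, x = a := fun x hx =>
      hA (· = a) a ha rfl (fun u _ w hw huw hu => by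
        subst hu
        exact absurd ⟨w, hw, huw⟩ hsingle) x hx
    refine ⟨some a, fun e he => ?_⟩
    induction e using Sym2.ind with | _ x y
    have h := ((hC x y).1 he).2
    rw [Sym2.mem_iff]
    by_contra! hno
    have key : ∀ z : Option V, some a ≠ z → z ∉ some '' (A : Set V) := by
      rintro z hz ⟨w, hw, rfl⟩
      exact hz (by rw [hAa w hw])
    exact h ⟨fun h => absurd h (key x hno.1), fun h => absurd h (key y hno.2)⟩

omit [Fintype V] in
/-- If the edges of the cut have a common endpoint, then no triangle has exactly two vertices in
`A`. -/
lemma card_inter_ne_two (hA' : IsLinked Q.polyhedronSkeleton (some '' (A : Set V))ᶜ)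
    (hC : ∀ x y, s(x, y) ∈ C ↔ Q.polyhedronSkeleton.Adj x y ∧
      ¬ (x ∈ some '' (A : Set V) ↔ y ∈ some '' (A : Set V)))
    {v : Option V} (hv : ∀ e ∈ C, v ∈ e) {T : Finset V} (hT : T ∈ Q.triangles) :
    (A ∩ T).card ≠ 2 := by
  have D := Q.isTriangulatedDisc
  intro h2
  obtain ⟨a, a', haa', hAT⟩ := Finset.card_eq_two.1 h2
  have ha : a ∈ A ∩ T := by simp [hAT]
  have ha' : a' ∈ A ∩ T := by simp [hAT]
  rw [Finset.mem_inter] at ha ha'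
  obtain ⟨b, hab, hab', rfl⟩ := D.exists_third hT ha.2 ha'.2 haa'
  have hb : b ∉ A := by
    intro hb
    have : b ∈ A ∩ {a, a', b} := by simp [hb]
    rw [hAT] at this
    simp only [Finset.mem_insert, Finset.mem_singleton] at this
    rcases this with h | h
    · exact hab h.symm
    · exact hab' h.symm
  have hcross : ∀ x y, (skeleton Q.triangles).Adj x y → x ∈ A → y ∉ A → v = some x ∨ v = some y := by
    intro x y hxy hx hy
    have := hv s(some x, some y) ((hC _ _).2 ⟨hxy, by simp [hx, hy]⟩)
    simpa using this
  have h1 := hcross a b ⟨hab, _, hT, by simp, by simp⟩ ha.1 hb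
  have h1' := hcross a' b ⟨hab', _, hT, by simp, by simp⟩ ha'.1 hb
  -- The edges from `a` and `a'` to `b` both lie in the cut and share only `b`.
  have hvb : v = some b := by
    rcases h1 with h1 | h1
    · rcases h1' with h1' | h1'
      · exact absurd (Option.some.inj (h1.symm.trans h1')) haa'
      · exact h1'
    · exact h1
  subst hvb
  have hinterior : ∀ x ∈ A, ¬ IsBoundaryVertex Q.triangles x := by
    intro x hx hbd
    have := hv s(some x, none) ((hC _ _).2 ⟨hbd, by simp [hx]⟩)
    simp only [Sym2.mem_iff, Option.some.injEq, reduceCtorEq, or_false] at this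
    exact hb (this ▸ hx)
  have hnbr : ∀ z, (skeleton Q.triangles).Adj b z → z ∈ A := fun z hz =>
    D.link_induction b (· ∈ A) (fun p q hp hq hpq hT' hpA => by
      by_contra hqA
      rcases hcross p q ⟨hpq, _, hT', by simp, by simp⟩ hpA hqA with h | h
      · exact hp (Option.some.inj h)
      · exact hq (Option.some.inj h)) (x := a) ⟨hab.symm, _, hT, by simp, by simp⟩ ha.1 hz
  have hbb : ¬ IsBoundaryVertex Q.triangles b := by
    rintro ⟨w, hw⟩
    exact hinterior w (hnbr w hw.adj) ⟨b, hw.symm⟩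
  -- All neighbours of `b` lie in `A` and `b` is interior, so `b` is cut off from `∞` within the
  -- complement of `A`, which is linked.
  refine hA' (· ≠ some b) none (by simp) (by simp) ?_ (some b) (by simpa using hb) rfl
  rintro x hx y - hxy - rfl
  rcases x with _ | x
  · exact hbb hxy
  · have hxb : (skeleton Q.triangles).Adj x b := hxy
    exact hx ⟨x, hnbr x hxb.symm, rfl⟩

end Cut

/-- The vertices on the side of a minimal cutset that does not contain `∞`. -/
lemma exists_finset_side {C : Finset (Sym2 (Option V))}
    (hC : IsMinimalCutset Q.polyhedronSkeleton C) :
    ∃ A : Finset V, A.Nonempty ∧ IsLinked (skeleton Q.triangles) (A : Set V) ∧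
      IsLinked Q.polyhedronSkeleton (some '' (A : Set V))ᶜ ∧
      ∀ x y, s(x, y) ∈ C ↔ Q.polyhedronSkeleton.Adj x y ∧
        ¬ (x ∈ some '' (A : Set V) ↔ y ∈ some '' (A : Set V)) := by
  classical
  obtain ⟨B, hnone, hne, hB, hB', hBC⟩ := hC.exists_side Q.skeleton_connected none
  have himg : some '' ((Finset.univ.filter fun v => some v ∈ B : Finset V) : Set V) = B := by
    ext x
    rcases x with _ | x <;> simp [hnone]
  refine ⟨Finset.univ.filter fun v => some v ∈ B, ?_, ?_, by rwa [himg], by rwa [himg]⟩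
  · obtain ⟨x, hx⟩ := hne
    rcases x with _ | x
    · exact absurd hx hnone
    · exact ⟨x, by simpa using hx⟩
  · intro P a ha hPa hP x hx
    have := hB (fun z => ∀ w, z = some w → P w) (some a) (by simpa using ha)
      (fun w h => Option.some.inj h ▸ hPa) (by
        rintro p hp q hq hpq hPp w rfl
        rcases p with _ | p
        · exact absurd hp hnone
        · exact hP p (by simpa using hp) w (by simpa using hq) hpq (hPp p rfl))
      (some x) (by simpa using hx)
    exact this x rfl

end TriangulatedPolygon

end IdealPolyhedron

/-! ### The main theorem. -/

theorem theorem3p12 {V : Type*} [Fintype V] [DecidableEq V]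
    (Q : IdealPolyhedron.TriangulatedPolygon V)
    (C : Finset (Sym2 (Option V)))
    (hC : IdealPolyhedron.IsMinimalCutset Q.polyhedronSkeleton C) :
    ((¬ ∃ v : Option V, ∀ e ∈ C, v ∈ e) →
      ∑ e ∈ C, Q.dihedralAngle e < ((C.card : ℝ) - 2) * Real.pi) ∧
    ((∃ v : Option V, ∀ e ∈ C, v ∈ e) →
      ∑ e ∈ C, Q.dihedralAngle e = ((C.card : ℝ) - 2) * Real.pi) := by
  obtain ⟨A, hne, hA, hA', hAC⟩ := Q.exists_finset_side hC
  rw [Q.sum_dihedralAngle hne hA hA' hAC]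
  constructor
  · intro hno
    obtain ⟨T, hT, h2⟩ : ∃ T ∈ Q.triangles, (A ∩ T).card = 2 := by
      by_contra! h
      exact hno (Q.exists_common_vertex hne hA hAC h)
    have := Finset.sum_lt_sum (f := Q.defect A) (g := fun _ => (0 : ℝ))
      (fun T hT => Q.defect_nonpos hT) ⟨T, hT, Q.defect_neg hT h2⟩
    rw [Finset.sum_const_zero] at this
    linarith
  · rintro ⟨v, hv⟩
    rw [Finset.sum_eq_zero fun T hT =>
      Q.defect_eq_zero hT (Q.card_inter_ne_two hA' hAC hv hT), add_zero]
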